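/- Let $\Omega=\prod_{i=1}^d(a_i,b_i)\subset\mathbb R^d$, let $\varepsilon>0$, $f(z)=z^3-z$, and let $(\cdot,\cdot)$ and $\|\cdot\|$ be the inner product and norm of $L^2(\Omega)$. Let $0=t_0<t_1<\dots<t_N$ be any time levels, $\tau_k=t_k-t_{k-1}$ and $r_k=\tau_k/\tau_{k-1}$ for $k\ge 2$. The variable-step BDF3 kernels are $b_0^{(1)}=\frac1{\tau_1}$, $\;b_0^{(2)}=\frac{1+2r_2}{\tau_2(1+r_2)}$, $\;b_1^{(2)}=-\frac{r_2^2}{\tau_2(1+r_2)}$, and for $n\ge3$, with $\Delta_n=\tau_n(1+r_n)(1+r_{n-1})(1+r_{n-1}+r_nr_{n-1})$, $$b_0^{(n)}=\frac{(1+r_{n-1})\left[1+2r_n+r_{n-1}(1+4r_n+3r_n^2)\right]}{\Delta_n},$$ $$b_1^{(n)}=-\frac{r_n^2\left[(1+2r_{n-1}+r_nr_{n-1})^2-r_{n-1}(1+r_{n-1})\right]}{\Delta_n},\qquad b_2^{(n)}=\frac{r_n^2r_{n-1}^3(1+r_n)^2}{\Delta_n},$$ and $b_j^{(n)}=0$ for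 $j\ge3$. Put $D_3u^n=\sum_{k=1}^n b_{n-k}^{(n)}(u^k-u^{k-1})$. Let $B$ be the lower triangular $N\times N$ matrix with the entry $b_{n-k}^{(n)}$ in row $n$ and column $k\le n$, let $\Lambda=\mathrm{diag}(\tau_1,\dots,\tau_N)$ and $\gamma=1/200$. Assume $B>\gamma\Lambda^{-1}$, that is, $x^T(B-\gamma\Lambda^{-1})x>0$ for all $0\ne x\in\mathbb R^N$. Let $(u^n)_{n=0}^N$ and $(\tilde u^n)_{n=0}^N$ in $H^1_{\rm per}(\Omega)$ be two solutions of the BDF3 scheme for the Allen–Cahn equation with periodic boundary conditions, $$D_3u^n-\varepsilon^2\Delta u^n+f(u^n)=0,\qquad 1\le n\le N,$$ in the weak sense: $f(u^n)\in L^2(\Omega)$ and $(D_3u^n,v)+\varepsilon^2(\nabla u^n,\nabla v)+(f(u^n),v)=0$ for all $v\in H^1_{\rm per}(\Omega)$; likewise for $\tilde u^n$. Let $\epsilon^n=\tilde u^n-u^n$. **Theorem 5.1.** (i) Let $c_\Omega$ be a constant of the embedding $H^1_{\rm per}(\Omega)\subseteq L^\infty(\Omega)$, i.e. $\|v\|_{L^\infty}\le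 c_\Omega(\|v\|^2+\|\nabla v\|^2)^{1/2}$ for all $v\in H^1_{\rm per}(\Omega)$. With $E(v)=\frac{\varepsilon^2}2\|\nabla v\|^2+\frac14\|v^2-1\|^2$ put $$c_1=\sqrt{4\varepsilon^{-2}E(u^0)+(2+\varepsilon^2)|\Omega|},\qquad \tilde c_1=\sqrt{4\varepsilon^{-2}E(\tilde u^0)+(2+\varepsilon^2)|\Omega|},$$ $$\tilde c=|\Omega|+c_\Omega^2c_1^2+c_\Omega^2c_1\tilde c_1+c_\Omega^2\tilde c_1^2 .$$ If the steps are so small that $2\gamma^{-1}\tilde c\,\tau_n<\frac12$ for $1\le n\le N$, then, with no further restriction on the steps, $$\|\epsilon^n\|\le 2\exp\left(4\gamma^{-1}\tilde c\,t_{n-1}\right)\|\epsilon^0\|,\qquad 1\le n\le N. \tag{1}$$ (ii) If $d=1$, such a constant $c_\Omega$ exists. (iii) In any dimension, (1) holds as well with any other constant $\tilde c$ such that $2\gamma^{-1}\tilde c\,\tau_n<\frac12$ and $|1-(u^n)^2-u^n\tilde u^n-(\tilde u^n)^2|\le\tilde c$ almost everywhere in $\Omega$ for $1\le n\le N$. 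-/

import Mathlib

open MeasureTheory
open scoped ContDiff

namespace BDF3

noncomputable section

/-! ### Time grid, kernels and matrices -/

/-- The time step `τ_k = t_k - t_{k-1}` (used for `k ≥ 1`). -/
def step (t : ℕ → ℝ) (k : ℕ) : ℝ := t k - t (k - 1)

/-- The adjacent step ratio `r_k = τ_k / τ_{k-1}` (used for `k ≥ 2`). -/
def ratio (t : ℕ → ℝ) (k : ℕ) : ℝ := step t k / step t (k - 1)

/-- The kernel `b_j^{(n)}` of the variable-step BDF3 method: BDF1 at the first level,
BDF2 at the second one, BDF3 from the third one on. -/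
def kernel (t : ℕ → ℝ) (n j : ℕ) : ℝ :=
  let τ := step t n
  let r := ratio t n
  let s := ratio t (n - 1)
  if n = 1 then
    if j = 0 then 1 / τ else 0
  else if n = 2 then
    if j = 0 then (1 + 2 * r) / (τ * (1 + r))
    else if j = 1 then -(r ^ 2) / (τ * (1 + r))
    else 0
  else
    if j = 0 then
      (1 + s) * (1 + 2 * r + s * (1 + 4 * r + 3 * r ^ 2)) /
        (τ * (1 + r) * (1 + s) * (1 + s + r * s))
    else if j = 1 then
      -(r ^ 2 * ((1 + 2 * s + r * s) ^ 2 - s * (1 + s))) /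
        (τ * (1 + r) * (1 + s) * (1 + s + r * s))
    else if j = 2 then
      r ^ 2 * s ^ 3 * (1 + r) ^ 2 / (τ * (1 + r) * (1 + s) * (1 + s + r * s))
    else 0

/-- The lower triangular `N × N` matrix `B` with the entry `b_{n-k}^{(n)}` in row `n` and
column `k ≤ n` (rows and columns are numbered from `1` in the mathematics, from `0` in `Fin N`). -/
def kernelMatrix (t : ℕ → ℝ) (N : ℕ) : Matrix (Fin N) (Fin N) ℝ :=
  Matrix.of fun i j =>
    if j ≤ i then kernel t ((i : ℕ) + 1) ((i : ℕ) - (j : ℕ)) else 0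

/-- `Λ = diag(τ_1, …, τ_N)`. -/
def stepMatrix (t : ℕ → ℝ) (N : ℕ) : Matrix (Fin N) (Fin N) ℝ :=
  Matrix.diagonal fun i => step t ((i : ℕ) + 1)

/-- `A > C` for real square matrices, not necessarily symmetric:
`xᵀ (A - C) x > 0` for all real vectors `x ≠ 0`. -/
def MatrixGT {N : ℕ} (A C : Matrix (Fin N) (Fin N) ℝ) : Prop :=
  ∀ x : Fin N → ℝ, x ≠ 0 → 0 < dotProduct x ((A - C).mulVec x)

/-- The constant `γ = 1/200`. -/
def gam : ℝ := 1 / 200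

/-- The discrete derivative
`(D₃ u)^n = ∑_{k=1}^n b_{n-k}^{(n)} (u^k - u^{k-1})` of a sequence of functions. -/
def D3 {X : Type*} (t : ℕ → ℝ) (u : ℕ → X → ℝ) (n : ℕ) (x : X) : ℝ :=
  ∑ k ∈ Finset.Icc 1 n, kernel t n (n - k) * (u k x - u (k - 1) x)

/-! ### Periodic Sobolev functions on a box -/

/-- The open box `Ω = ∏ (a_i, b_i)`, the period cell. -/
def cell {d : ℕ} (a b : Fin d → ℝ) : Set (EuclideanSpace ℝ (Fin d)) :=
  {x | ∀ i, x i ∈ Set.Ioo (a i) (b i)}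

/-- Lebesgue measure on `Ω`. -/
def cellMeasure {d : ℕ} (a b : Fin d → ℝ) : Measure (EuclideanSpace ℝ (Fin d)) :=
  volume.restrict (cell a b)

/-- The Lebesgue measure `|Ω|` of the box. -/
def cellVolume {d : ℕ} (a b : Fin d → ℝ) : ℝ := volume.real (cell a b)

/-- Smooth functions on `ℝ^d` of period `b_i - a_i` in the `i`-th variable. -/
def IsPeriodicTest {d : ℕ} (a b : Fin d → ℝ) (φ : EuclideanSpace ℝ (Fin d) → ℝ) : Prop :=
  ContDiff ℝ ∞ φ ∧ ∀ i x, φ (x + EuclideanSpace.single i (b i - a i)) = φ x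

/-- `v ∈ H¹_per(Ω)` with weak gradient `q`: both are square integrable on `Ω` and
`∫_Ω v ∂_i φ = - ∫_Ω q_i φ` for all smooth periodic `φ` and all `i`. -/
structure HasPeriodicWeakGrad {d : ℕ} (a b : Fin d → ℝ)
    (v : EuclideanSpace ℝ (Fin d) → ℝ)
    (q : EuclideanSpace ℝ (Fin d) → EuclideanSpace ℝ (Fin d)) : Prop where
  memLp : MemLp v 2 (cellMeasure a b)
  memLp_grad : MemLp q 2 (cellMeasure a b)
  integral_by_parts : ∀ φ, IsPeriodicTest a b φ → ∀ i,
    ∫ x, v x * fderiv ℝ φ x (EuclideanSpace.single i 1) ∂(cellMeasure a b) =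
      -∫ x, q x i * φ x ∂(cellMeasure a b)

/-- The norm of `L²(Ω)`, for functions in `L²(Ω)` with values in a normed space. -/
def l2norm {d : ℕ} {F : Type*} [NormedAddCommGroup F] (a b : Fin d → ℝ)
    (v : EuclideanSpace ℝ (Fin d) → F) : ℝ :=
  Real.sqrt (∫ x, ‖v x‖ ^ 2 ∂(cellMeasure a b))

/-- `c` is a constant of the embedding `H¹_per(Ω) ⊆ L^∞(Ω)`, that is,
`‖v‖_{L^∞} ≤ c ‖v‖_{H¹}` for all `v ∈ H¹_per(Ω)`, where
`‖v‖_{H¹}² = ‖v‖² + ‖∇v‖²`. -/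
def IsEmbeddingConstant {d : ℕ} (a b : Fin d → ℝ) (c : ℝ) : Prop :=
  ∀ v q, HasPeriodicWeakGrad a b v q →
    ∀ᵐ x ∂(cellMeasure a b), |v x| ≤ c * Real.sqrt (l2norm a b v ^ 2 + l2norm a b q ^ 2)

/-! ### The Allen-Cahn equation and its discretization -/

/-- The bulk force `f(z) = z³ - z`. -/
def force (z : ℝ) : ℝ := z ^ 3 - z

/-- The free energy `E(v) = (ε²/2) ‖∇v‖² + (1/4) ‖v² - 1‖²`, where `q = ∇v`. -/
def energy {d : ℕ} (a b : Fin d → ℝ) (ε : ℝ)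
    (v : EuclideanSpace ℝ (Fin d) → ℝ)
    (q : EuclideanSpace ℝ (Fin d) → EuclideanSpace ℝ (Fin d)) : ℝ :=
  ε ^ 2 / 2 * l2norm a b q ^ 2 + 1 / 4 * l2norm a b (fun x => v x ^ 2 - 1) ^ 2

/-- `u^0, …, u^N ∈ H¹_per(Ω)`, with gradients `p^0, …, p^N`, is a solution of the BDF3 scheme
`D₃ u^n - ε² Δ u^n + f(u^n) = 0`, `1 ≤ n ≤ N`, with periodic boundary conditions.
The equation is read in its weak form, with test functions in `H¹_per(Ω)`. -/
structure IsSchemeSolution {d : ℕ} (a b : Fin d → ℝ) (ε : ℝ) (t : ℕ → ℝ) (N : ℕ)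
    (u : ℕ → EuclideanSpace ℝ (Fin d) → ℝ)
    (p : ℕ → EuclideanSpace ℝ (Fin d) → EuclideanSpace ℝ (Fin d)) : Prop where
  mem_H1 : ∀ n ≤ N, HasPeriodicWeakGrad a b (u n) (p n)
  memLp_force : ∀ n, 1 ≤ n → n ≤ N → MemLp (fun x => force (u n x)) 2 (cellMeasure a b)
  weak_eq : ∀ n, 1 ≤ n → n ≤ N → ∀ v q, HasPeriodicWeakGrad a b v q →
    (∫ x, D3 t u n x * v x ∂(cellMeasure a b))
      + ε ^ 2 * (∫ x, inner ℝ (p n x) (q x) ∂(cellMeasure a b))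
      + (∫ x, force (u n x) * v x ∂(cellMeasure a b)) = 0

/-- The a priori `H¹` bound `√(4 ε⁻² E(u⁰) + (2 + ε²) |Ω|)`, as a function of the energy
`E₀ = E(u⁰)` of the initial value. -/
def h1Bound {d : ℕ} (a b : Fin d → ℝ) (ε E₀ : ℝ) : ℝ :=
  Real.sqrt (4 * (ε ^ 2)⁻¹ * E₀ + (2 + ε ^ 2) * cellVolume a b)

/-- The constant `c̃ = |Ω| + c_Ω² c₁² + c_Ω² c₁ c̃₁ + c_Ω² c̃₁²`. -/
def stabConst {d : ℕ} (a b : Fin d → ℝ) (cΩ c₁ c₁' : ℝ) : ℝ :=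
  cellVolume a b + cΩ ^ 2 * c₁ ^ 2 + cΩ ^ 2 * c₁ * c₁' + cΩ ^ 2 * c₁' ^ 2

/-- The difference quotient `f̃_u = 1 - u² - u ũ - ũ²`, for which
`f(u) - f(ũ) = f̃_u · (ũ - u)`. -/
def forceQuot (z z' : ℝ) : ℝ := 1 - z ^ 2 - z * z' - z' ^ 2

end

end BDF3

namespace BDF3

/-! ### The kernel matrix -/

/-! Write `e` for the difference of the solutions and `δ` for its increments. At each point the
scheme reads `A δ + (diffusion) = w`, with `A` the kernel matrix of the first `n` levels and `|w i|
≤ c |e i|`. Testing the equations with the combinations of the errors given by the transpose of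
`A⁻¹` removes the kernels: the time term becomes `∑ e (k+1) * δ k` and telescopes, while the
diffusion is nonnegative because the quadratic form of `A⁻¹` is. The lower bound `γ Λ⁻¹` on `A`
bounds the reaction by `γ⁻¹ c ∑ τ e²` (`inv_bilinForm_le`). Absorbing the last summand and applying
Gronwall finishes (iii); the step ratios matter only through this lower bound.

For (i), testing with the increments of a solution gives energy decay
(`IsSchemeSolution.energy_le`). The energy controls the `H¹` norm, hence the maximum norm through
the embedding, hence `c`. The smallness `τ ≤ 2γ` needed here is implied by the step condition, since
`c̃ ≥ 2` (`two_le_stabConst`).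

Part (ii) is a duality argument: a bump minus its mean is the derivative of a periodic function
bounded by `1`. -/

theorem gam_pos : 0 < gam := by norm_num [gam]

theorem step_pos {t : ℕ → ℝ} {N : ℕ} (ht : ∀ k < N, t k < t (k + 1)) {k : ℕ} (hk : k < N) :
    0 < step t (k + 1) := by
  simpa [step] using ht k hk

/-- `∑ᵢ xᵢ (A x)ᵢ ≥ γ ∑ᵢ xᵢ² / τᵢ`, the consequence of `A > γ Λ⁻¹` in coordinates. -/
theorem le_quadForm {n : ℕ} {A : Matrix (Fin n) (Fin n) ℝ} {t : ℕ → ℝ}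
    (hA : MatrixGT A (gam • (stepMatrix t n)⁻¹)) (ht : ∀ k < n, t k < t (k + 1))
    (x : Fin n → ℝ) :
    gam * ∑ i, x i ^ 2 / step t (i + 1) ≤ ∑ i, x i * ∑ j, A i j * x j := by
  rcases eq_or_ne x 0 with rfl | hx
  · simp
  have h := hA x hx
  have hinv : (stepMatrix t n)⁻¹ = Matrix.diagonal fun i : Fin n => (step t ((i : ℕ) + 1))⁻¹ := by
    apply Matrix.inv_eq_right_inv
    rw [stepMatrix, Matrix.diagonal_mul_diagonal, ← Matrix.diagonal_one]
    congr 1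
    funext i
    exact mul_inv_cancel₀ (step_pos ht i.2).ne'
  rw [hinv, Matrix.sub_mulVec, dotProduct_sub, Matrix.smul_mulVec, dotProduct_smul, sub_pos] at h
  refine le_trans (le_of_eq ?_) h.le
  rw [smul_eq_mul, dotProduct]
  congr 1
  refine Finset.sum_congr rfl fun i _ => ?_
  rw [Matrix.mulVec_diagonal]
  ring

theorem kernelMatrix_apply (t : ℕ → ℝ) {n : ℕ} (i j : Fin n) :
    kernelMatrix t n i j = if (j : ℕ) ≤ i then kernel t (i + 1) (i - j) else 0 :=
  rfl

/-- The leading principal blocks of the kernel matrix inherit the lower bound. -/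
theorem le_quadForm_kernelMatrix {N n : ℕ} {t : ℕ → ℝ}
    (hB : MatrixGT (kernelMatrix t N) (gam • (stepMatrix t N)⁻¹))
    (ht : ∀ k < N, t k < t (k + 1)) (hn : n ≤ N) (x : Fin n → ℝ) :
    gam * ∑ i, x i ^ 2 / step t (i + 1) ≤ ∑ i, x i * ∑ j, kernelMatrix t n i j * x j := by
  obtain ⟨m, rfl⟩ := Nat.exists_eq_add_of_le hn
  -- Padding by zeros suffices: the entries do not depend on the size of the matrix.
  have h := le_quadForm hB ht (Fin.append x 0)
  simp only [Fin.sum_univ_add, Fin.append_left, Fin.append_right, Pi.zero_apply, Fin.val_castAdd]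
    at h
  simpa [kernelMatrix_apply] using h

/-! ### Inverse of a matrix with coercive quadratic form -/

section Inverse

variable {n : ℕ} {A : Matrix (Fin n) (Fin n) ℝ} {τ : Fin n → ℝ} {g : ℝ}

theorem isUnit_det_of_quadForm (hg : 0 < g) (hτ : ∀ i, 0 < τ i)
    (hA : ∀ x : Fin n → ℝ, g * ∑ i, x i ^ 2 / τ i ≤ ∑ i, x i * ∑ j, A i j * x j) :
    IsUnit A.det := by
  rw [isUnit_iff_ne_zero]
  intro h0
  obtain ⟨x, hx, hAx⟩ := Matrix.exists_mulVec_eq_zero_iff.2 h0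
  apply hx
  have h := hA x
  have h1 : ∀ i, ∑ j, A i j * x j = 0 := fun i => congrFun hAx i
  simp only [h1, mul_zero, Finset.sum_const_zero] at h
  have h2 : ∑ i, x i ^ 2 / τ i ≤ 0 := by nlinarith
  have hnn : ∀ i ∈ Finset.univ, 0 ≤ x i ^ 2 / τ i := fun i _ =>
    div_nonneg (sq_nonneg _) (hτ i).le
  have h3 := (Finset.sum_eq_zero_iff_of_nonneg hnn).1 (le_antisymm h2 (Finset.sum_nonneg hnn))
  funext i
  simpa [(hτ i).ne'] using h3 i (Finset.mem_univ i)

theorem inv_quadForm_nonneg (hg : 0 < g) (hτ : ∀ i, 0 < τ i)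
    (hA : ∀ x : Fin n → ℝ, g * ∑ i, x i ^ 2 / τ i ≤ ∑ i, x i * ∑ j, A i j * x j)
    (x : Fin n → ℝ) : 0 ≤ ∑ i, x i * ∑ j, A⁻¹ i j * x j := by
  have hu := isUnit_det_of_quadForm hg hτ hA
  have h := hA (A⁻¹.mulVec x)
  have hx : ∀ i, ∑ j, A i j * A⁻¹.mulVec x j = x i := fun i => by
    have : A.mulVec (A⁻¹.mulVec x) = x := by
      rw [Matrix.mulVec_mulVec, Matrix.mul_nonsing_inv _ hu, Matrix.one_mulVec]
    exact congrFun this i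
  simp only [hx] at h
  have h0 : 0 ≤ g * ∑ i, A⁻¹.mulVec x i ^ 2 / τ i :=
    mul_nonneg hg.le (Finset.sum_nonneg fun i _ => div_nonneg (sq_nonneg _) (hτ i).le)
  refine (h0.trans h).trans (le_of_eq (Finset.sum_congr rfl fun i _ => ?_))
  rw [mul_comm]
  rfl

/-- For `y = A⁻¹ w`, coercivity and a weighted Young inequality bound `∑ y² / τ` by `(c / g)² ∑ τ
e²`. Cauchy–Schwarz with the dual weights `τ` and `1 / τ` concludes. Neither symmetry nor an upper
bound of `A` enters. -/
theorem inv_bilinForm_le (hg : 0 < g) (hτ : ∀ i, 0 < τ i)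
    (hA : ∀ x : Fin n → ℝ, g * ∑ i, x i ^ 2 / τ i ≤ ∑ i, x i * ∑ j, A i j * x j)
    {c : ℝ} (hc : 0 ≤ c) {e w : Fin n → ℝ} (hw : ∀ i, |w i| ≤ c * |e i|) :
    ∑ i, e i * ∑ j, A⁻¹ i j * w j ≤ g⁻¹ * c * ∑ i, τ i * e i ^ 2 := by
  have hu := isUnit_det_of_quadForm hg hτ hA
  set y := A⁻¹.mulVec w with hy
  have hAy : ∀ i, ∑ j, A i j * y j = w i := fun i => by
    have : A.mulVec y = w := by
      rw [hy, Matrix.mulVec_mulVec, Matrix.mul_nonsing_inv _ hu, Matrix.one_mulVec]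
    exact congrFun this i
  have h := hA y
  simp only [hAy] at h
  change ∑ i, e i * y i ≤ _
  set Y := ∑ i, y i ^ 2 / τ i
  set T := ∑ i, τ i * e i ^ 2
  have hT : 0 ≤ T := Finset.sum_nonneg fun i _ => mul_nonneg (hτ i).le (sq_nonneg _)
  have hyw : 2 * g * ∑ i, y i * w i ≤ g ^ 2 * Y + c ^ 2 * T := by
    simp only [Y, T, Finset.mul_sum, ← Finset.sum_add_distrib]
    refine Finset.sum_le_sum fun i _ => ?_
    have hw2 : w i ^ 2 ≤ c ^ 2 * e i ^ 2 := by
      rw [← sq_abs (w i), ← sq_abs (e i), ← mul_pow]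
      exact pow_le_pow_left₀ (abs_nonneg _) (hw i) 2
    have h1 : 0 ≤ (g * y i - τ i * w i) ^ 2 / τ i := div_nonneg (sq_nonneg _) (hτ i).le
    have h2 : (g * y i - τ i * w i) ^ 2 / τ i
        = g ^ 2 * (y i ^ 2 / τ i) + τ i * w i ^ 2 - 2 * g * (y i * w i) := by
      have := (hτ i).ne'
      field_simp
      ring
    nlinarith [mul_le_mul_of_nonneg_left hw2 (hτ i).le]
  have hY : g ^ 2 * Y ≤ c ^ 2 * T := by nlinarith
  have hcs : (∑ i, e i * y i) ^ 2 ≤ T * Y := by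
    refine Finset.sum_sq_le_sum_mul_sum_of_sq_le_mul _
      (fun i _ => mul_nonneg (hτ i).le (sq_nonneg _))
      (fun i _ => div_nonneg (sq_nonneg _) (hτ i).le) fun i _ => ?_
    have := (hτ i).ne'
    refine le_of_eq ?_
    field_simp
  have hY' : Y ≤ g⁻¹ ^ 2 * (c ^ 2 * T) := by
    rw [inv_pow, ← div_eq_inv_mul, le_div_iff₀ (by positivity)]
    linarith
  refine le_of_sq_le_sq ?_ (by positivity)
  nlinarith [mul_le_mul_of_nonneg_left hY' hT]

end Inverse

/-- Row `i` belongs to level `i + 1` and column `j` to the increment from level `j` to `j + 1`, so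
both shifts cancel in the kernel index. -/
theorem D3_succ {X : Type*} (t : ℕ → ℝ) (u : ℕ → X → ℝ) {n : ℕ} (i : Fin n) (x : X) :
    D3 t u (i + 1) x = ∑ j, kernelMatrix t n i j * (u (j + 1) x - u j x) := by
  have h : ∑ j : Fin n, kernelMatrix t n i j * (u (j + 1) x - u j x)
      = ∑ j ∈ Finset.range n, (if j ≤ i then kernel t (i + 1) (i - j) else 0)
          * (u (j + 1) x - u j x) := by
    rw [← Fin.sum_univ_eq_sum_range (fun j => (if j ≤ i then kernel t (i + 1) (i - j) else 0)
          * (u (j + 1) x - u j x))]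
    simp only [kernelMatrix_apply]
  have hsub : Finset.range (i + 1) ⊆ Finset.range n := by
    simp
  rw [h, ← Finset.sum_subset hsub, D3, Finset.range_eq_Ico, ← Finset.Ico_add_one_right_eq_Icc,
    ← Finset.sum_Ico_add' _ 0 ((i : ℕ) + 1) 1]
  · refine Finset.sum_congr rfl fun j hj => ?_
    rw [if_pos (by simp at hj; omega)]
    simp
  · intro j _ hj
    rw [if_neg (by simpa [Nat.lt_succ_iff] using hj), zero_mul]

theorem D3_sub {X : Type*} (t : ℕ → ℝ) (u v : ℕ → X → ℝ) (n : ℕ) (x : X) :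
    D3 t (fun k => u k - v k) n x = D3 t u n x - D3 t v n x := by
  simp only [D3, ← Finset.sum_sub_distrib]
  refine Finset.sum_congr rfl fun k _ => ?_
  simp only [Pi.sub_apply]
  ring

/-! ### Discrete Gronwall inequality -/

/-- The induction bounds the right-hand side of the hypothesis, which grows per level by at most `1
+ C τ ≤ exp (C τ)`. The sum omits the current level, hence the exponent `t n` in the bound for `y (n
+ 1)`. -/
theorem discrete_gronwall {N : ℕ} {t y : ℕ → ℝ} {A C : ℝ} (ht0 : t 0 = 0)
    (hA : 0 ≤ A) (hC : 0 ≤ C) (ht : ∀ k < N, t k ≤ t (k + 1))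
    (h : ∀ n < N, y (n + 1) ≤ A + C * ∑ k ∈ Finset.range n, (t (k + 1) - t k) * y (k + 1)) :
    ∀ n < N, y (n + 1) ≤ A * Real.exp (C * t n) := by
  have key : ∀ n, n < N →
      A + C * ∑ k ∈ Finset.range n, (t (k + 1) - t k) * y (k + 1) ≤ A * Real.exp (C * t n) := by
    intro n
    induction n with
    | zero => simp [ht0]
    | succ n ih =>
      intro hn
      have h1 := ih (by omega)
      have hτ : 0 ≤ t (n + 1) - t n := sub_nonneg.2 (ht n (by omega))
      have h2 := (h n (by omega)).trans h1
      rw [Finset.sum_range_succ, mul_add, ← add_assoc]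
      have h3 : C * ((t (n + 1) - t n) * y (n + 1))
          ≤ C * ((t (n + 1) - t n) * (A * Real.exp (C * t n))) := by gcongr
      have h4 : 1 + C * (t (n + 1) - t n) ≤ Real.exp (C * (t (n + 1) - t n)) := by
        linarith [Real.add_one_le_exp (C * (t (n + 1) - t n))]
      calc _ ≤ A * Real.exp (C * t n) * (1 + C * (t (n + 1) - t n)) := by linarith
        _ ≤ A * Real.exp (C * t n) * Real.exp (C * (t (n + 1) - t n)) := by gcongr
        _ = A * Real.exp (C * t (n + 1)) := by
          rw [mul_assoc, ← Real.exp_add]; ring_nf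
  exact fun n hn => (h n hn).trans (key n hn)

/-! ### The period cell -/

section Cell

variable {d : ℕ} {a b : Fin d → ℝ}

theorem cell_eq_preimage (a b : Fin d → ℝ) :
    cell a b = WithLp.ofLp ⁻¹' (Set.univ.pi fun i => Set.Ioo (a i) (b i)) := by
  ext x
  simp [cell]

theorem measurableSet_cell (a b : Fin d → ℝ) : MeasurableSet (cell a b) := by
  rw [cell_eq_preimage]
  exact (PiLp.volume_preserving_ofLp (Fin d)).measurable
    (MeasurableSet.univ_pi fun i => measurableSet_Ioo)

theorem volume_cell (a b : Fin d → ℝ) :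
    volume (cell a b) = ∏ i, ENNReal.ofReal (b i - a i) := by
  rw [cell_eq_preimage, (PiLp.volume_preserving_ofLp (Fin d)).measure_preimage
    (MeasurableSet.univ_pi fun i => measurableSet_Ioo).nullMeasurableSet, Real.volume_pi_Ioo]

instance isFiniteMeasure_cellMeasure (a b : Fin d → ℝ) : IsFiniteMeasure (cellMeasure a b) := by
  refine ⟨?_⟩
  rw [cellMeasure, Measure.restrict_apply_univ, volume_cell]
  exact ENNReal.prod_lt_top fun i _ => ENNReal.ofReal_lt_top

theorem cellVolume_pos (hab : ∀ i, a i < b i) : 0 < cellVolume a b := by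
  rw [cellVolume, measureReal_def, volume_cell, ENNReal.toReal_prod]
  refine Finset.prod_pos fun i _ => ?_
  rw [ENNReal.toReal_ofReal (sub_nonneg.2 (hab i).le)]
  exact sub_pos.2 (hab i)

theorem cellMeasure_real_univ (a b : Fin d → ℝ) :
    (cellMeasure a b).real Set.univ = cellVolume a b := by
  simp [cellMeasure, cellVolume, measureReal_def]

theorem cellMeasure_neZero (hab : ∀ i, a i < b i) : NeZero (cellMeasure a b) := by
  refine ⟨fun h => (cellVolume_pos hab).ne' ?_⟩
  rw [← cellMeasure_real_univ, h]
  simp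

theorem memLp_of_continuous {F : Type*} [NormedAddCommGroup F]
    {g : EuclideanSpace ℝ (Fin d) → F} (hg : Continuous g) (q : ENNReal) :
    MemLp g q (cellMeasure a b) := by
  have hcpt : IsCompact (WithLp.ofLp ⁻¹' (Set.univ.pi fun i => Set.Icc (a i) (b i)) :
      Set (EuclideanSpace ℝ (Fin d))) :=
    (PiLp.homeomorph 2 (fun _ : Fin d => ℝ)).isCompact_preimage.2
      (isCompact_univ_pi fun i => isCompact_Icc)
  obtain ⟨C, hC⟩ := hcpt.exists_bound_of_continuousOn hg.continuousOn
  refine MemLp.of_bound hg.aestronglyMeasurable C ?_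
  filter_upwards [ae_restrict_mem (measurableSet_cell a b)] with x hx
  exact hC x fun i _ => Set.Ioo_subset_Icc_self (hx i)

end Cell

/-! ### Periodic Sobolev functions -/

section Sobolev

variable {d : ℕ} {a b : Fin d → ℝ} {φ : EuclideanSpace ℝ (Fin d) → ℝ}
  {v w : EuclideanSpace ℝ (Fin d) → ℝ}
  {q r : EuclideanSpace ℝ (Fin d) → EuclideanSpace ℝ (Fin d)}

theorem IsPeriodicTest.memLp (h : IsPeriodicTest a b φ) : MemLp φ 2 (cellMeasure a b) :=
  memLp_of_continuous h.1.continuous 2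

theorem IsPeriodicTest.continuous_fderiv_apply (h : IsPeriodicTest a b φ)
    (e : EuclideanSpace ℝ (Fin d)) : Continuous fun x => fderiv ℝ φ x e :=
  (h.1.continuous_fderiv (by simp)).clm_apply continuous_const

theorem IsPeriodicTest.memLp_fderiv (h : IsPeriodicTest a b φ) (e : EuclideanSpace ℝ (Fin d)) :
    MemLp (fun x => fderiv ℝ φ x e) 2 (cellMeasure a b) :=
  memLp_of_continuous (h.continuous_fderiv_apply e) 2

theorem memLp_coord {μ : Measure (EuclideanSpace ℝ (Fin d))} (hq : MemLp q 2 μ) (i : Fin d) :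
    MemLp (fun x => q x i) 2 μ := by
  refine hq.mono ?_ (Filter.Eventually.of_forall fun x => PiLp.norm_apply_le (q x) i)
  exact (PiLp.continuous_apply 2 (fun _ : Fin d => ℝ) i).comp_aestronglyMeasurable hq.1

theorem integrable_mul_of_memLp {α : Type*} [MeasurableSpace α] {μ : Measure α} {f g : α → ℝ}
    (hf : MemLp f 2 μ) (hg : MemLp g 2 μ) : Integrable (fun x => f x * g x) μ :=
  hf.integrable_mul hg

theorem HasPeriodicWeakGrad.add (hv : HasPeriodicWeakGrad a b v q)
    (hw : HasPeriodicWeakGrad a b w r) : HasPeriodicWeakGrad a b (v + w) (q + r) where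
  memLp := hv.memLp.add hw.memLp
  memLp_grad := hv.memLp_grad.add hw.memLp_grad
  integral_by_parts φ hφ i := by
    have hD := hφ.memLp_fderiv (EuclideanSpace.single i 1)
    simp only [Pi.add_apply, PiLp.add_apply, add_mul]
    rw [integral_add (integrable_mul_of_memLp hv.memLp hD) (integrable_mul_of_memLp hw.memLp hD),
      integral_add (integrable_mul_of_memLp (memLp_coord hv.memLp_grad i) hφ.memLp)
        (integrable_mul_of_memLp (memLp_coord hw.memLp_grad i) hφ.memLp),
      hv.integral_by_parts φ hφ i, hw.integral_by_parts φ hφ i, neg_add]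

theorem HasPeriodicWeakGrad.const_smul (c : ℝ) (hv : HasPeriodicWeakGrad a b v q) :
    HasPeriodicWeakGrad a b (c • v) (c • q) where
  memLp := hv.memLp.const_smul c
  memLp_grad := hv.memLp_grad.const_smul c
  integral_by_parts φ hφ i := by
    simp only [Pi.smul_apply, PiLp.smul_apply, smul_eq_mul, mul_assoc, integral_const_mul]
    rw [hv.integral_by_parts φ hφ i, mul_neg]

theorem HasPeriodicWeakGrad.sub (hv : HasPeriodicWeakGrad a b v q)
    (hw : HasPeriodicWeakGrad a b w r) : HasPeriodicWeakGrad a b (v - w) (q - r) := by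
  simpa [sub_eq_add_neg] using hv.add (hw.const_smul (-1))

theorem hasPeriodicWeakGrad_zero :
    HasPeriodicWeakGrad a b 0 0 where
  memLp := MemLp.zero
  memLp_grad := MemLp.zero
  integral_by_parts φ _ i := by simp

theorem HasPeriodicWeakGrad.sum {ι : Type*} (s : Finset ι)
    {v : ι → EuclideanSpace ℝ (Fin d) → ℝ}
    {q : ι → EuclideanSpace ℝ (Fin d) → EuclideanSpace ℝ (Fin d)}
    (h : ∀ k ∈ s, HasPeriodicWeakGrad a b (v k) (q k)) :
    HasPeriodicWeakGrad a b (∑ k ∈ s, v k) (∑ k ∈ s, q k) := by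
  classical
  induction s using Finset.induction_on with
  | empty => simpa using hasPeriodicWeakGrad_zero
  | insert k s hk ih =>
    rw [Finset.sum_insert hk, Finset.sum_insert hk]
    exact (h k (Finset.mem_insert_self k s)).add
      (ih fun j hj => h j (Finset.mem_insert_of_mem hj))

theorem integral_cell_eq_integral_Icc (g : EuclideanSpace ℝ (Fin d) → ℝ) :
    ∫ x, g x ∂(cellMeasure a b) = ∫ y in Set.Icc a b, g (WithLp.toLp 2 y) := by
  have hmp := PiLp.volume_preserving_ofLp (Fin d)
  rw [volume_pi, ← setIntegral_congr_set (Measure.univ_pi_Ioo_ae_eq_Icc (f := a) (g := b)),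
    cellMeasure, cell_eq_preimage]
  exact hmp.setIntegral_preimage_emb
    (MeasurableEquiv.toLp 2 (Fin d → ℝ)).symm.measurableEmbedding (fun y => g (WithLp.toLp 2 y)) _

/-- The integral of a partial derivative of a periodic function over a period cell vanishes. -/
theorem integral_fderiv_periodic (hab : ∀ i, a i < b i) (h : IsPeriodicTest a b φ) (i : Fin d) :
    ∫ x, fderiv ℝ φ x (EuclideanSpace.single i 1) ∂(cellMeasure a b) = 0 := by
  obtain _ | n := d
  · exact i.elim0
  let L : (Fin (n + 1) → ℝ) →L[ℝ] EuclideanSpace ℝ (Fin (n + 1)) :=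
    (EuclideanSpace.equiv (Fin (n + 1)) ℝ).symm.toContinuousLinearMap
  have hL : ∀ y, L y = WithLp.toLp 2 y := fun y => rfl
  have hd : ∀ y, HasFDerivAt (fun y => φ (L y)) ((fderiv ℝ φ (L y)).comp L) y := fun y =>
    ((h.1.differentiable (by simp)) (L y)).hasFDerivAt.comp y L.hasFDerivAt
  have hcont : Continuous fun y => φ (L y) := h.1.continuous.comp L.continuous
  have hs : ∀ y, (∑ j, (if j = i then (fderiv ℝ φ (L y)).comp L else 0) (Pi.single j 1))
      = fderiv ℝ φ (L y) (EuclideanSpace.single i 1) := fun y => by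
    rw [Finset.sum_eq_single i (fun j _ hj => by simp [hj]) (by simp)]
    simp only [if_true, ContinuousLinearMap.comp_apply, hL]
    rfl
  -- Divergence theorem for the field whose only nonzero component is the `i`-th, equal to `φ`;
  -- periodicity cancels the two opposite faces.
  have hdiv := integral_divergence_of_hasFDerivAt_off_countable' a b (fun j => (hab j).le)
    (fun j y => if j = i then φ (L y) else 0)
    (fun j y => if j = i then (fderiv ℝ φ (L y)).comp L else 0) ∅ Set.countable_empty
    (fun j => by
      by_cases hj : j = i
      · simpa [hj] using hcont.continuousOn
      · simpa [hj] using continuousOn_const)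
    (fun y _ j => by
      by_cases hj : j = i
      · simpa [hj] using hd y
      · simpa [hj] using hasFDerivAt_const (0 : ℝ) y)
    (by
      simp only [hs]
      exact ((h.continuous_fderiv_apply _).comp L.continuous).continuousOn.integrableOn_compact
        isCompact_Icc)
  rw [integral_cell_eq_integral_Icc]
  refine (integral_congr_ae (Filter.Eventually.of_forall fun y => (hs y).symm)).trans
    (hdiv.trans ?_)
  simp only [hL]
  refine Finset.sum_eq_zero fun j _ => ?_
  by_cases hj : j = i
  · subst hj
    simp only [if_true]
    rw [sub_eq_zero]
    refine integral_congr_ae (Filter.Eventually.of_forall fun y => ?_)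
    simp only
    rw [← h.2 j (WithLp.toLp 2 (j.insertNth (a j) y))]
    congr 1
    ext k
    rcases Fin.eq_self_or_eq_succAbove j k with rfl | ⟨m, rfl⟩
    · simp
    · simp [Fin.succAbove_ne]
  · simp [hj]

theorem hasPeriodicWeakGrad_one (hab : ∀ i, a i < b i) :
    HasPeriodicWeakGrad a b (fun _ => 1) 0 where
  memLp := memLp_const 1
  memLp_grad := MemLp.zero
  integral_by_parts φ hφ i := by simp [integral_fderiv_periodic hab hφ i]

end Sobolev

/-! ### The embedding of `H¹_per` into `L^∞` in dimension one -/

section Circle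

variable {α β : ℝ}

/-- A smooth function that vanishes outside of a compact part of `(α, β)` has a smooth periodic
extension from `(α, β)`. -/
theorem exists_periodic_extension {ψ : ℝ → ℝ} (hψ : ContDiff ℝ ∞ ψ) {α' β' : ℝ}
    (hα : α < α') (hαβ : α' ≤ β') (hβ : β' < β) (h0 : ∀ x, x ∉ Set.Icc α' β' → ψ x = 0) :
    ∃ P : ℝ → ℝ, ContDiff ℝ ∞ P ∧ Function.Periodic P (β - α) ∧
      ∀ x ∈ Set.Ico α β, P x = ψ x := by
  have hL : 0 < β - α := by linarith
  have hper : Function.Periodic (fun x => ψ (toIcoMod hL α x)) (β - α) := fun x => by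
    simp only [toIcoMod_add_right]
  have hid : ∀ x ∈ Set.Ico α β, ψ (toIcoMod hL α x) = ψ x := fun x hx => by
    rw [(toIcoMod_eq_self hL).2 (by simpa using hx)]
  refine ⟨fun x => ψ (toIcoMod hL α x), ?_, hper, hid⟩
  -- The periodization agrees with `ψ` even slightly to the left of `α`: there both vanish, as the
  -- point shifted by a period lies beyond `β'`. This gives smoothness at the seam.
  have hloc : ∀ x ∈ Set.Ioo (β' - (β - α)) β, ψ (toIcoMod hL α x) = ψ x := fun x hx => by
    rcases le_or_gt α x with h | h
    · exact hid x ⟨h, hx.2⟩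
    · rw [← toIcoMod_add_right hL α x, (toIcoMod_eq_self hL).2
        ⟨by linarith [hx.1], by linarith⟩, h0 x fun hx' => by linarith [hx'.1],
        h0 _ fun hx' => by linarith [hx'.2, hx.1]]
  refine contDiff_iff_contDiffAt.2 fun x => ?_
  set y := toIcoMod hL α x with hy
  have hyI := toIcoMod_mem_Ico hL α x
  have hP : (fun x => ψ (toIcoMod hL α x)) =
      (fun x => ψ (toIcoMod hL α x)) ∘ fun z => z + (y - x) := by
    funext z
    have : y - x = (-toIcoDiv hL α x) • (β - α) := by
      rw [hy, toIcoMod, neg_smul]; ring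
    simp only [Function.comp, this, toIcoMod_add_zsmul]
  rw [hP]
  refine ContDiffAt.comp x ?_ (contDiff_id.add contDiff_const).contDiffAt
  have hxy : x + (y - x) = y := by ring
  rw [hxy]
  refine hψ.contDiffAt.congr_of_eventuallyEq ?_
  filter_upwards [Ioo_mem_nhds (show β' - (β - α) < y by linarith [hyI.1])
    (show y < β by linarith [hyI.2])] with z hz
  exact hloc z hz

/-- A smooth periodic nonnegative function of integral `1` over a period differs from a constant
by the derivative of a smooth periodic function that is bounded by `1` on the period. -/
theorem exists_periodic_primitive (hαβ : α < β) {P : ℝ → ℝ} (hP : ContDiff ℝ ∞ P)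
    (hper : Function.Periodic P (β - α)) (hnn : ∀ x, 0 ≤ P x) (h1 : ∫ x in α..β, P x = 1) :
    ∃ φ : ℝ → ℝ, ContDiff ℝ ∞ φ ∧ Function.Periodic φ (β - α) ∧
      (∀ x, deriv φ x = P x - (β - α)⁻¹) ∧ ∀ x ∈ Set.Icc α β, |φ x| ≤ 1 := by
  have hL : 0 < β - α := by linarith
  have hc : Continuous fun x => P x - (β - α)⁻¹ := hP.continuous.sub continuous_const
  have hd : ∀ x, HasDerivAt (fun x => ∫ y in α..x, (P y - (β - α)⁻¹)) (P x - (β - α)⁻¹) x :=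
    fun x => hc.integral_hasStrictDerivAt α x |>.hasDerivAt
  have hint : ∀ x y, IntervalIntegrable P volume x y := fun x y =>
    hP.continuous.intervalIntegrable x y
  refine ⟨fun x => ∫ y in α..x, (P y - (β - α)⁻¹), ?_, fun x => ?_, fun x => (hd x).deriv,
    fun x hx => ?_⟩
  · refine contDiff_infty_iff_deriv.2 ⟨fun x => (hd x).differentiableAt, ?_⟩
    rw [show deriv (fun x => ∫ y in α..x, (P y - (β - α)⁻¹)) = fun x => P x - (β - α)⁻¹ from
      funext fun x => (hd x).deriv]
    exact hP.sub contDiff_const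
  · have h2 : ∫ y in x..x + (β - α), P y = 1 := by
      rw [hper.intervalIntegral_add_eq x α]
      simpa using h1
    simp only
    rw [← intervalIntegral.integral_add_adjacent_intervals (hc.intervalIntegrable α x)
      (hc.intervalIntegrable x (x + (β - α))), intervalIntegral.integral_sub
      (hint x (x + (β - α))) intervalIntegrable_const (a := x), h2]
    simp [hL.ne']
  · simp only
    rw [intervalIntegral.integral_sub (hint _ _) intervalIntegrable_const]
    have h3 : 0 ≤ ∫ y in α..x, P y := intervalIntegral.integral_nonneg hx.1 fun y _ => hnn y
    have h4 : ∫ y in α..x, P y ≤ 1 := by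
      rw [← h1, ← intervalIntegral.integral_add_adjacent_intervals (hint α x) (hint x β)]
      linarith [intervalIntegral.integral_nonneg (μ := volume) hx.2 fun y _ => hnn y]
    -- `φ x` is a difference of two numbers in `[0, 1]`.
    have h5 : 0 ≤ (x - α) * (β - α)⁻¹ := mul_nonneg (by linarith [hx.1]) (by positivity)
    have h6 : (x - α) * (β - α)⁻¹ ≤ 1 := by
      rw [← div_eq_mul_inv, div_le_one hL]; linarith [hx.2]
    rw [intervalIntegral.integral_const, smul_eq_mul, abs_le]
    constructor <;> linarith

/-- A function with an integrable periodic weak derivative is essentially bounded. -/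
theorem ae_abs_le_of_periodic_weak_deriv (hαβ : α < β) {V Q : ℝ → ℝ}
    (hV : IntegrableOn V (Set.Ioo α β)) (hQ : IntegrableOn Q (Set.Ioo α β))
    (h : ∀ φ : ℝ → ℝ, ContDiff ℝ ∞ φ → Function.Periodic φ (β - α) →
      ∫ x in Set.Ioo α β, V x * deriv φ x = -∫ x in Set.Ioo α β, Q x * φ x) :
    ∀ᵐ x ∂(volume.restrict (Set.Ioo α β)),
      |V x| ≤ (β - α)⁻¹ * (∫ x in Set.Ioo α β, |V x|) + ∫ x in Set.Ioo α β, |Q x| := by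
  have hL : 0 < β - α := by linarith
  -- Pairings with probability densities supported inside the interval are bounded independently of
  -- the density.
  have key : ∀ ψ : ℝ → ℝ, ContDiff ℝ ∞ ψ → ∀ α' β', α < α' → α' ≤ β' → β' < β →
      (∀ x, x ∉ Set.Icc α' β' → ψ x = 0) → (∀ x, 0 ≤ ψ x) → ∫ x, ψ x = 1 →
      |∫ x in Set.Ioo α β, V x * ψ x|
        ≤ (β - α)⁻¹ * (∫ x in Set.Ioo α β, |V x|) + ∫ x in Set.Ioo α β, |Q x| := by
    intro ψ hψ α' β' h1 h2 h3 h0 hnn hint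
    obtain ⟨P, hP, hper, hPψ⟩ := exists_periodic_extension hψ h1 h2 h3 h0
    have hP0 : ∀ x, 0 ≤ P x := fun x => by
      obtain ⟨y, hy, hxy⟩ := hper.exists_mem_Ico hL x α
      rw [hxy, hPψ y (by simpa using hy)]
      exact hnn y
    have hP1 : ∫ x in α..β, P x = 1 := by
      rw [intervalIntegral.integral_of_le hαβ.le, integral_Ioc_eq_integral_Ioo,
        setIntegral_congr_fun measurableSet_Ioo fun x hx => hPψ x ⟨hx.1.le, hx.2⟩, ← hint]
      refine setIntegral_eq_integral_of_forall_compl_eq_zero fun x hx => h0 x fun hx' => hx ?_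
      exact ⟨by linarith [hx'.1], by linarith [hx'.2]⟩
    obtain ⟨φ, hφ, hφper, hφd, hφ1⟩ := exists_periodic_primitive hαβ hP hper hP0 hP1
    have hVd : IntegrableOn (fun x => V x * deriv φ x) (Set.Ioo α β) := by
      refine hV.mul_continuousOn_of_subset ?_ measurableSet_Ioo isCompact_Icc
        Set.Ioo_subset_Icc_self
      exact (hφ.continuous_deriv (by simp)).continuousOn
    have hsplit : ∫ x in Set.Ioo α β, V x * ψ x
        = (-∫ x in Set.Ioo α β, Q x * φ x) + (β - α)⁻¹ * ∫ x in Set.Ioo α β, V x := by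
      rw [← h φ hφ hφper, ← integral_const_mul, ← integral_add hVd (hV.const_mul _)]
      refine setIntegral_congr_fun measurableSet_Ioo fun x hx => ?_
      simp only [hφd, hPψ x ⟨hx.1.le, hx.2⟩]
      ring
    have hb1 : |∫ x in Set.Ioo α β, Q x * φ x| ≤ ∫ x in Set.Ioo α β, |Q x| := by
      refine (abs_integral_le_integral_abs).trans ?_
      refine integral_mono_of_nonneg (Filter.Eventually.of_forall fun x => abs_nonneg _) hQ.abs ?_
      filter_upwards [ae_restrict_mem measurableSet_Ioo] with x hx
      rw [abs_mul]
      exact mul_le_of_le_one_right (abs_nonneg _) (hφ1 x (Set.Ioo_subset_Icc_self hx))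
    have hb2 : |∫ x in Set.Ioo α β, V x| ≤ ∫ x in Set.Ioo α β, |V x| :=
      abs_integral_le_integral_abs
    rw [hsplit]
    refine (abs_add_le _ _).trans ?_
    rw [abs_neg, abs_mul, abs_of_pos (inv_pos.2 hL), add_comm]
    gcongr
  -- Shrinking bumps with bounded ratio of radii, here `2`, so that the mollified functions converge
  -- almost everywhere.
  let η : ℕ → ContDiffBump (0 : ℝ) := fun n =>
    ⟨(1 / ((n : ℝ) + 1)) / 2, 1 / ((n : ℝ) + 1), by positivity, half_lt_self (by positivity)⟩
  have hη : Filter.Tendsto (fun n => (η n).rOut) Filter.atTop (nhds 0) :=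
    tendsto_one_div_add_atTop_nhds_zero_nat
  have hg : LocallyIntegrable ((Set.Ioo α β).indicator V) volume :=
    (hV.integrable_indicator measurableSet_Ioo).locallyIntegrable
  have hconv := ContDiffBump.ae_convolution_tendsto_right_of_locallyIntegrable (μ := volume)
    (K := 2) hη (Filter.Eventually.of_forall fun n => by simp only [η]; linarith) hg
  rw [ae_restrict_iff' measurableSet_Ioo]
  filter_upwards [hconv] with x hx hxI
  rw [Set.indicator_of_mem hxI] at hx
  refine le_of_tendsto hx.abs ?_
  have hev : ∀ᶠ n in Filter.atTop, (η n).rOut < min (x - α) (β - x) :=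
    hη.eventually_lt_const (lt_min (by linarith [hxI.1]) (by linarith [hxI.2]))
  filter_upwards [hev] with n hn
  have hn1 := hn.trans_le (min_le_left _ _)
  have hn2 := hn.trans_le (min_le_right _ _)
  have hpos := (η n).rOut_pos
  have heq : (MeasureTheory.convolution ((η n).normed volume) ((Set.Ioo α β).indicator V)
      (ContinuousLinearMap.lsmul ℝ ℝ) volume) x
      = ∫ y in Set.Ioo α β, V y * (η n).normed volume (x - y) := by
    rw [convolution_eq_swap, ← integral_indicator measurableSet_Ioo]
    refine integral_congr_ae (Filter.Eventually.of_forall fun y => ?_)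
    by_cases hy : y ∈ Set.Ioo α β <;> simp [hy, mul_comm]
  rw [heq]
  refine key (fun y => (η n).normed volume (x - y))
    ((η n).contDiff_normed.comp (contDiff_const.sub contDiff_id)) (x - (η n).rOut)
    (x + (η n).rOut) (by linarith) (by linarith) (by linarith) (fun y hy => ?_)
    (fun y => (η n).nonneg_normed _) ?_
  · rw [ContDiffBump.normed_def, (η n).zero_of_le_dist, zero_div]
    rw [dist_zero_right, Real.norm_eq_abs]
    by_contra hlt
    rw [not_le, abs_lt] at hlt
    exact hy ⟨by linarith [hlt.2], by linarith [hlt.1]⟩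
  · rw [integral_sub_left_eq_self (fun y => (η n).normed volume y) volume x]
    exact (η n).integral_normed

end Circle

/-- Cauchy–Schwarz against the constant `1`, by expanding `∫ (M ‖f‖ - S)² ≥ 0`. -/
theorem sq_integral_abs_le {α : Type*} [MeasurableSpace α] {μ : Measure α} [IsFiniteMeasure μ]
    {F : Type*} [NormedAddCommGroup F] {f : α → F} (hf : MemLp f 2 μ) :
    (∫ x, ‖f x‖ ∂μ) ^ 2 ≤ μ.real Set.univ * ∫ x, ‖f x‖ ^ 2 ∂μ := by
  have hi : Integrable (fun x => ‖f x‖) μ := (hf.integrable one_le_two).norm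
  have hi2 : Integrable (fun x => ‖f x‖ ^ 2) μ := hf.integrable_norm_pow (by simp)
  set S := ∫ x, ‖f x‖ ∂μ
  set M := μ.real Set.univ
  have hM : 0 ≤ M := measureReal_nonneg
  have h : 0 ≤ ∫ x, (M * ‖f x‖ - S) ^ 2 ∂μ := integral_nonneg fun x => sq_nonneg _
  have hi3 : Integrable (fun x => M ^ 2 * ‖f x‖ ^ 2 - 2 * M * S * ‖f x‖) μ :=
    (hi2.const_mul _).sub (hi.const_mul _)
  have h2 : ∫ x, (M * ‖f x‖ - S) ^ 2 ∂μ
      = M ^ 2 * (∫ x, ‖f x‖ ^ 2 ∂μ) - 2 * M * S * S + M * S ^ 2 := by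
    rw [← integral_const_mul, show 2 * M * S * S = ∫ x, 2 * M * S * ‖f x‖ ∂μ from
      (integral_const_mul _ _).symm, show M * S ^ 2 = ∫ _, S ^ 2 ∂μ by simp [M],
      ← integral_sub (hi2.const_mul _) (hi.const_mul _),
      ← integral_add hi3 (integrable_const _)]
    congr 1
    funext x
    ring
  rcases hM.eq_or_lt with h0 | hpos
  · have : μ = 0 := by
      rw [eq_comm, measureReal_eq_zero_iff, Measure.measure_univ_eq_zero] at h0
      exact h0
    have hS : S = 0 := by simp [S, this]
    rw [hS, ← h0]
    simp
  · rw [h2] at h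
    have : 0 ≤ M * (M * (∫ x, ‖f x‖ ^ 2 ∂μ) - S ^ 2) := by linarith
    linarith [nonneg_of_mul_nonneg_right this hpos]

/-- In dimension one `H¹_per` embeds into `L^∞`. -/
theorem exists_isEmbeddingConstant {a b : Fin 1 → ℝ} (hab : ∀ i, a i < b i) :
    ∃ c, IsEmbeddingConstant a b c := by
  have h0 := hab 0
  have hL : 0 < b 0 - a 0 := sub_pos.2 h0
  let E : ℝ ≃ᵐ EuclideanSpace ℝ (Fin 1) :=
    (MeasurableEquiv.funUnique (Fin 1) ℝ).symm.trans (MeasurableEquiv.toLp 2 (Fin 1 → ℝ))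
  have hE0 : ∀ s i, E s i = s := fun s i => rfl
  have hEx : ∀ x : EuclideanSpace ℝ (Fin 1), E (x 0) = x := fun x => by
    ext i
    rw [hE0, Subsingleton.elim i 0]
  have hEmp : MeasurePreserving E volume volume :=
    (PiLp.volume_preserving_toLp (Fin 1)).comp (volume_preserving_funUnique (Fin 1) ℝ).symm
  have hpre : E ⁻¹' cell a b = Set.Ioo (a 0) (b 0) := by
    ext s
    simp [cell, hE0]
  have hmp : MeasurePreserving E (volume.restrict (Set.Ioo (a 0) (b 0))) (cellMeasure a b) := by
    rw [← hpre]
    exact hEmp.restrict_preimage (measurableSet_cell a b)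
  have hvol : (cellMeasure a b).real Set.univ = b 0 - a 0 := by
    rw [cellMeasure_real_univ, cellVolume, measureReal_def, volume_cell]
    simp [hL.le]
  -- Each `L¹` norm is at most `√L` times the `L²` norm, where `L` is the length, and each `L²` norm
  -- is at most the `H¹` norm.
  refine ⟨(b 0 - a 0)⁻¹ * Real.sqrt (b 0 - a 0) + Real.sqrt (b 0 - a 0), fun v q hvq => ?_⟩
  have hqc := memLp_coord hvq.memLp_grad 0
  have hb := ae_abs_le_of_periodic_weak_deriv h0 (V := fun s => v (E s)) (Q := fun s => q (E s) 0)
    ((hvq.memLp.comp_measurePreserving hmp).integrable one_le_two)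
    ((hqc.comp_measurePreserving hmp).integrable one_le_two) fun φ hφ hper => by
      have hcoord : ∀ x : EuclideanSpace ℝ (Fin 1),
          HasFDerivAt (fun x : EuclideanSpace ℝ (Fin 1) => x 0)
            (EuclideanSpace.proj (𝕜 := ℝ) (0 : Fin 1)) x := fun x =>
        (EuclideanSpace.proj (𝕜 := ℝ) (0 : Fin 1)).hasFDerivAt
      have htest : IsPeriodicTest a b fun x => φ (x 0) := by
        refine ⟨hφ.comp (EuclideanSpace.proj (𝕜 := ℝ) (0 : Fin 1)).contDiff, fun i x => ?_⟩
        rw [Subsingleton.elim i 0]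
        simpa using hper (x 0)
      have hfd : ∀ x : EuclideanSpace ℝ (Fin 1),
          fderiv ℝ (fun x : EuclideanSpace ℝ (Fin 1) => φ (x 0)) x (EuclideanSpace.single 0 1)
            = deriv φ (x 0) := fun x => by
        have h1 := (hφ.differentiable (by simp) (x 0)).hasDerivAt.comp_hasFDerivAt x (hcoord x)
        rw [show (fun x : EuclideanSpace ℝ (Fin 1) => φ (x 0)) = φ ∘ fun x => x 0 from rfl,
          h1.fderiv]
        simp
      have h2 := hvq.integral_by_parts _ htest 0
      simp only [hfd] at h2
      rw [← hmp.integral_comp E.measurableEmbedding, ← hmp.integral_comp E.measurableEmbedding]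
        at h2
      simpa only [hE0] using h2
  have hbound : (b 0 - a 0)⁻¹ * (∫ s in Set.Ioo (a 0) (b 0), |v (E s)|)
      + ∫ s in Set.Ioo (a 0) (b 0), |q (E s) 0|
      ≤ ((b 0 - a 0)⁻¹ * Real.sqrt (b 0 - a 0) + Real.sqrt (b 0 - a 0))
        * Real.sqrt (l2norm a b v ^ 2 + l2norm a b q ^ 2) := by
    rw [hmp.integral_comp E.measurableEmbedding (fun x => |v x|),
      hmp.integral_comp E.measurableEmbedding (fun x => |q x 0|), add_mul, mul_assoc,
      ← Real.sqrt_mul hL.le]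
    have hv2 : 0 ≤ ∫ x, ‖v x‖ ^ 2 ∂cellMeasure a b := integral_nonneg fun x => sq_nonneg _
    have hq2 : 0 ≤ ∫ x, ‖q x‖ ^ 2 ∂cellMeasure a b := integral_nonneg fun x => sq_nonneg _
    rw [l2norm, l2norm, Real.sq_sqrt hv2, Real.sq_sqrt hq2]
    have hA := sq_integral_abs_le hvq.memLp
    have hB := sq_integral_abs_le hvq.memLp_grad
    rw [hvol] at hA hB
    have hqq : ∫ x, |q x 0| ∂cellMeasure a b ≤ ∫ x, ‖q x‖ ∂cellMeasure a b :=
      integral_mono (hqc.integrable one_le_two).abs (hvq.memLp_grad.integrable one_le_two).norm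
        fun x => PiLp.norm_apply_le (q x) 0
    gcongr
    · refine Real.le_sqrt_of_sq_le (hA.trans ?_)
      gcongr
      linarith
    · refine hqq.trans (Real.le_sqrt_of_sq_le (hB.trans ?_))
      gcongr
      linarith
  rw [← hmp.map_eq, E.measurableEmbedding.ae_map_iff]
  filter_upwards [hb] with s hs
  exact hs.trans hbound

/-! ### Integrals over the period cell -/

section Scheme

variable {d : ℕ} {a b : Fin d → ℝ}

theorem l2norm_nonneg {F : Type*} [NormedAddCommGroup F] (v : EuclideanSpace ℝ (Fin d) → F) :
    0 ≤ l2norm a b v :=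
  Real.sqrt_nonneg _

theorem l2norm_sq {F : Type*} [NormedAddCommGroup F] (v : EuclideanSpace ℝ (Fin d) → F) :
    l2norm a b v ^ 2 = ∫ x, ‖v x‖ ^ 2 ∂(cellMeasure a b) :=
  Real.sq_sqrt (integral_nonneg fun _ => sq_nonneg _)

theorem integrable_inner_of_memLp {q r : EuclideanSpace ℝ (Fin d) → EuclideanSpace ℝ (Fin d)}
    (hq : MemLp q 2 (cellMeasure a b)) (hr : MemLp r 2 (cellMeasure a b)) :
    Integrable (fun x => inner ℝ (q x) (r x)) (cellMeasure a b) := by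
  simp only [PiLp.inner_apply]
  exact integrable_finsetSum _ fun i _ =>
    (integrable_mul_of_memLp (memLp_coord hr i) (memLp_coord hq i))

theorem memLp_D3 {t : ℕ → ℝ} {u : ℕ → EuclideanSpace ℝ (Fin d) → ℝ} {n : ℕ}
    (hu : ∀ k ≤ n, MemLp (u k) 2 (cellMeasure a b)) :
    MemLp (D3 t u n) 2 (cellMeasure a b) := by
  refine memLp_finsetSum _ fun k hk => ?_
  rw [Finset.mem_Icc] at hk
  exact ((hu k hk.2).sub (hu (k - 1) (by omega))).const_mul _

/-! ### Telescoping sums -/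

theorem le_sum_mul_sub (e : ℕ → ℝ) (n : ℕ) :
    1 / 2 * (e n ^ 2 - e 0 ^ 2) ≤ ∑ k : Fin n, e (k + 1) * (e (k + 1) - e k) := by
  rw [Fin.sum_univ_eq_sum_range (fun k => e (k + 1) * (e (k + 1) - e k)),
    ← Finset.sum_range_sub (fun k => e k ^ 2), Finset.mul_sum]
  exact Finset.sum_le_sum fun k _ => by nlinarith [sq_nonneg (e (k + 1) - e k)]

theorem sum_mul_sum_comm {n : ℕ} (Θ : Matrix (Fin n) (Fin n) ℝ) (f g : Fin n → ℝ) :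
    ∑ j, f j * ∑ k, Θ k j * g k = ∑ k, g k * ∑ j, Θ k j * f j := by
  simp only [Finset.mul_sum]
  rw [Finset.sum_comm]
  exact Finset.sum_congr rfl fun k _ => Finset.sum_congr rfl fun j _ => by ring

/-- The orthogonality that makes the kernels disappear after testing. -/
theorem sum_inv_mul_self {n : ℕ} {A : Matrix (Fin n) (Fin n) ℝ} (hA : IsUnit A.det)
    (δ g : Fin n → ℝ) :
    ∑ j, (∑ l, A j l * δ l) * ∑ k, A⁻¹ k j * g k = ∑ k, g k * δ k := by
  rw [sum_mul_sum_comm]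
  refine Finset.sum_congr rfl fun k _ => ?_
  have h : A⁻¹.mulVec (A.mulVec δ) = δ := by
    rw [Matrix.mulVec_mulVec, Matrix.nonsing_inv_mul _ hA, Matrix.one_mulVec]
  exact congrArg (g k * ·) (congrFun h k)

/-! ### Stability -/

variable {ε : ℝ} {N : ℕ} {t : ℕ → ℝ} {u u' : ℕ → EuclideanSpace ℝ (Fin d) → ℝ}
  {p p' : ℕ → EuclideanSpace ℝ (Fin d) → EuclideanSpace ℝ (Fin d)}

theorem force_sub_force (z z' : ℝ) : force z - force z' = forceQuot z z' * (z' - z) := by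
  simp only [force, forceQuot]
  ring

/-- The weak equation as a single integral. -/
theorem IsSchemeSolution.integral_weak_eq (hu : IsSchemeSolution a b ε t N u p) {n : ℕ}
    (h1 : 1 ≤ n) (hn : n ≤ N) {v : EuclideanSpace ℝ (Fin d) → ℝ}
    {q : EuclideanSpace ℝ (Fin d) → EuclideanSpace ℝ (Fin d)} (hv : HasPeriodicWeakGrad a b v q) :
    Integrable (fun x => D3 t u n x * v x + ε ^ 2 * inner ℝ (p n x) (q x) + force (u n x) * v x)
      (cellMeasure a b) ∧
    ∫ x, (D3 t u n x * v x + ε ^ 2 * inner ℝ (p n x) (q x) + force (u n x) * v x)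
      ∂(cellMeasure a b) = 0 := by
  have hD := integrable_mul_of_memLp
    (memLp_D3 (t := t) fun k hk => (hu.mem_H1 k (hk.trans hn)).memLp) hv.memLp
  have hp := (integrable_inner_of_memLp (hu.mem_H1 n hn).memLp_grad hv.memLp_grad).const_mul
    (ε ^ 2)
  have hf := integrable_mul_of_memLp (hu.memLp_force n h1 hn) hv.memLp
  have hDp : Integrable (fun x => D3 t u n x * v x + ε ^ 2 * inner ℝ (p n x) (q x))
      (cellMeasure a b) := hD.add hp
  have e := hu.weak_eq n h1 hn v q hv
  rw [← integral_const_mul, ← integral_add hD hp, ← integral_add hDp hf] at e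
  exact ⟨hDp.add hf, e⟩

/-- The weak equation satisfied by the difference of two solutions. -/
theorem IsSchemeSolution.integral_weak_eq_sub (hu : IsSchemeSolution a b ε t N u p)
    (hu' : IsSchemeSolution a b ε t N u' p') {n : ℕ} (h1 : 1 ≤ n) (hn : n ≤ N)
    {v : EuclideanSpace ℝ (Fin d) → ℝ} {q : EuclideanSpace ℝ (Fin d) → EuclideanSpace ℝ (Fin d)}
    (hv : HasPeriodicWeakGrad a b v q) :
    Integrable (fun x => D3 t (fun k => u' k - u k) n x * v x
        + ε ^ 2 * inner ℝ ((p' n - p n) x) (q x)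
        - (force (u n x) - force (u' n x)) * v x) (cellMeasure a b) ∧
    ∫ x, (D3 t (fun k => u' k - u k) n x * v x
        + ε ^ 2 * inner ℝ ((p' n - p n) x) (q x)
        - (force (u n x) - force (u' n x)) * v x) ∂(cellMeasure a b) = 0 := by
  obtain ⟨hs, e⟩ := hu.integral_weak_eq h1 hn hv
  obtain ⟨hs', e'⟩ := hu'.integral_weak_eq h1 hn hv
  have heq : (fun x => D3 t (fun k => u' k - u k) n x * v x
        + ε ^ 2 * inner ℝ ((p' n - p n) x) (q x)
        - (force (u n x) - force (u' n x)) * v x) =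
      fun x => (D3 t u' n x * v x + ε ^ 2 * inner ℝ (p' n x) (q x) + force (u' n x) * v x)
        - (D3 t u n x * v x + ε ^ 2 * inner ℝ (p n x) (q x) + force (u n x) * v x) := by
    funext x
    rw [D3_sub, Pi.sub_apply, inner_sub_left]
    ring
  rw [heq]
  refine ⟨hs'.sub hs, ?_⟩
  rw [integral_sub hs' hs, e, e', sub_zero]

/-- The `L²` energy estimate for the difference of two solutions. -/
theorem IsSchemeSolution.l2norm_sub_sq_le (hu : IsSchemeSolution a b ε t N u p)
    (hu' : IsSchemeSolution a b ε t N u' p') (ht : ∀ k < N, t k < t (k + 1))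
    (hB : MatrixGT (kernelMatrix t N) (gam • (stepMatrix t N)⁻¹)) {c : ℝ} (hc : 0 ≤ c)
    (hquot : ∀ n, 1 ≤ n → n ≤ N →
      ∀ᵐ x ∂(cellMeasure a b), |forceQuot (u n x) (u' n x)| ≤ c)
    {n : ℕ} (hn : n ≤ N) :
    l2norm a b (u' n - u n) ^ 2 ≤ l2norm a b (u' 0 - u 0) ^ 2
      + 2 * gam⁻¹ * c * ∑ k ∈ Finset.range n,
        (t (k + 1) - t k) * l2norm a b (u' (k + 1) - u (k + 1)) ^ 2 := by
  have hle : ∀ i : Fin n, (i : ℕ) + 1 ≤ N := fun i => i.2.trans_le hn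
  set A := kernelMatrix t n
  have hA := le_quadForm_kernelMatrix hB ht hn
  have hτ : ∀ i : Fin n, 0 < step t (i + 1) := fun i => step_pos ht (i.2.trans_le hn)
  have hdet := isUnit_det_of_quadForm gam_pos hτ hA
  set e : ℕ → EuclideanSpace ℝ (Fin d) → ℝ := fun k => u' k - u k
  set π : ℕ → EuclideanSpace ℝ (Fin d) → EuclideanSpace ℝ (Fin d) := fun k => p' k - p k
  have heπ : ∀ k ≤ N, HasPeriodicWeakGrad a b (e k) (π k) := fun k hk =>
    (hu'.mem_H1 k hk).sub (hu.mem_H1 k hk)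
  -- The transpose of `A⁻¹` appears because `j` numbers the equation being tested.
  let v : Fin n → EuclideanSpace ℝ (Fin d) → ℝ := fun j => ∑ k : Fin n, A⁻¹ k j • e (k + 1)
  let q : Fin n → EuclideanSpace ℝ (Fin d) → EuclideanSpace ℝ (Fin d) := fun j =>
    ∑ k : Fin n, A⁻¹ k j • π (k + 1)
  have hvq : ∀ j, HasPeriodicWeakGrad a b (v j) (q j) := fun j =>
    HasPeriodicWeakGrad.sum _ fun k _ => (heπ (k + 1) (by omega)).const_smul _
  have hweak := fun j : Fin n =>
    hu.integral_weak_eq_sub hu' (n := (j : ℕ) + 1) (by omega) (by omega) (hvq j)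
  have hsum := integral_finsetSum Finset.univ (fun j _ => (hweak j).1)
  rw [Finset.sum_eq_zero fun j _ => (hweak j).2] at hsum
  have hsq : ∀ k ≤ N, Integrable (fun x => e k x ^ 2) (cellMeasure a b) := fun k hk =>
    (heπ k hk).memLp.integrable_sq
  have hT : Integrable (fun x => gam⁻¹ * c * ∑ i : Fin n, step t (i + 1) * e (i + 1) x ^ 2)
      (cellMeasure a b) :=
    (integrable_finsetSum _ fun (i : Fin n) _ => (hsq (i + 1) (hle i)).const_mul _).const_mul _
  have hdiff : Integrable (fun x => 1 / 2 * (e n x ^ 2 - e 0 x ^ 2)) (cellMeasure a b) :=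
    ((hsq n hn).sub (hsq 0 (Nat.zero_le N))).const_mul _
  have hae : ∀ᵐ x ∂(cellMeasure a b), ∀ i : Fin n,
      |forceQuot (u (i + 1) x) (u' (i + 1) x)| ≤ c :=
    ae_all_iff.2 fun i => hquot (i + 1) (by omega) (hle i)
  -- The matrix inequalities are applied pointwise in `x`, then integrated.
  have hmono := integral_mono_ae (hdiff.sub hT) (integrable_finsetSum _ fun j _ => (hweak j).1) (by
    filter_upwards [hae] with x hx
    simp only [Finset.sum_sub_distrib, Finset.sum_add_distrib, Pi.sub_apply]
    have hv : ∀ j, v j x = ∑ k, A⁻¹ k j * e (k + 1) x := fun j => by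
      simp [v, Finset.sum_apply]
    have hq : ∀ j, q j x = ∑ k, A⁻¹ k j • π (k + 1) x := fun j => by
      simp [q, Finset.sum_apply]
    have hI : 1 / 2 * (e n x ^ 2 - e 0 x ^ 2) ≤ ∑ j : Fin n, D3 t e (j + 1) x * v j x := by
      simp only [hv, D3_succ t e]
      rw [sum_inv_mul_self hdet]
      exact le_sum_mul_sub (fun k => e k x) n
    have hII : 0 ≤ ∑ j : Fin n, ε ^ 2 * inner ℝ (π (j + 1) x) (q j x) := by
      rw [← Finset.mul_sum]
      refine mul_nonneg (sq_nonneg _) ?_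
      -- Each coordinate of the gradients gives one quadratic form of `A⁻¹`.
      simp only [hq, inner_sum, inner_smul_right, PiLp.inner_apply, Finset.mul_sum]
      rw [Finset.sum_congr rfl fun j _ => Finset.sum_comm, Finset.sum_comm]
      refine Finset.sum_nonneg fun i _ => ?_
      refine (inv_quadForm_nonneg gam_pos hτ hA fun k => π (k + 1) x i).trans (le_of_eq ?_)
      rw [← sum_mul_sum_comm]
      simp only [Finset.mul_sum]
      refine Finset.sum_congr rfl fun j _ => Finset.sum_congr rfl fun k _ => ?_
      simp
      ring
    have hIII : ∑ j : Fin n, (force (u (j + 1) x) - force (u' (j + 1) x)) * v j x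
        ≤ gam⁻¹ * c * ∑ i : Fin n, step t (i + 1) * e (i + 1) x ^ 2 := by
      simp only [hv]
      rw [sum_mul_sum_comm]
      refine inv_bilinForm_le gam_pos hτ hA hc fun i => ?_
      rw [force_sub_force, abs_mul]
      exact mul_le_mul_of_nonneg_right (hx i) (abs_nonneg _)
    change 1 / 2 * (e n x ^ 2 - e 0 x ^ 2)
      - gam⁻¹ * c * ∑ i : Fin n, step t (i + 1) * e (i + 1) x ^ 2
      ≤ ∑ j : Fin n, D3 t e (j + 1) x * v j x
        + ∑ j : Fin n, ε ^ 2 * inner ℝ (π (j + 1) x) (q j x)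
        - ∑ j : Fin n, (force (u (j + 1) x) - force (u' (j + 1) x)) * v j x
    linarith)
  rw [hsum] at hmono
  simp only [Pi.sub_apply] at hmono
  rw [integral_sub hdiff hT, integral_const_mul, integral_sub (hsq n hn) (hsq 0 (Nat.zero_le N)),
    integral_const_mul, integral_finsetSum _ fun (i : Fin n) _ => (hsq (i + 1) (hle i)).const_mul _]
    at hmono
  simp only [integral_const_mul] at hmono
  have hl : ∀ k, l2norm a b (e k) ^ 2 = ∫ x, e k x ^ 2 ∂(cellMeasure a b) := fun k => by
    rw [l2norm_sq]
    simp only [Real.norm_eq_abs, sq_abs]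
  change l2norm a b (e n) ^ 2 ≤ l2norm a b (e 0) ^ 2
      + 2 * gam⁻¹ * c * ∑ k ∈ Finset.range n, (t (k + 1) - t k) * l2norm a b (e (k + 1)) ^ 2
  rw [← Fin.sum_univ_eq_sum_range
    (fun k => (t (k + 1) - t k) * l2norm a b (e (k + 1)) ^ 2)]
  simp only [hl]
  have hstep : ∀ k : Fin n, step t (k + 1) = t (k + 1) - t k := fun k => by simp [step]
  simp only [hstep] at hmono
  linarith

/-- Stability of the scheme in `L²`, when the difference quotient of the force is bounded. -/
theorem IsSchemeSolution.l2norm_sub_le (hab : ∀ i, a i < b i)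
    (hu : IsSchemeSolution a b ε t N u p)
    (hu' : IsSchemeSolution a b ε t N u' p') (ht0 : t 0 = 0) (ht : ∀ k < N, t k < t (k + 1))
    (hB : MatrixGT (kernelMatrix t N) (gam • (stepMatrix t N)⁻¹)) {c : ℝ}
    (hquot : ∀ n, 1 ≤ n → n ≤ N →
      ∀ᵐ x ∂(cellMeasure a b), |forceQuot (u n x) (u' n x)| ≤ c)
    (hstep : ∀ n, 1 ≤ n → n ≤ N → 2 * gam⁻¹ * c * step t n < 1 / 2)
    {n : ℕ} (h1 : 1 ≤ n) (hn : n ≤ N) :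
    l2norm a b (u' n - u n) ≤
      2 * Real.exp (4 * gam⁻¹ * c * t (n - 1)) * l2norm a b (u' 0 - u 0) := by
  have hγ := inv_pos.2 gam_pos
  -- A bound of absolute values, valid at some point since the cell has positive measure.
  have hc : 0 ≤ c := by
    have := cellMeasure_neZero hab
    obtain ⟨x, hx⟩ := (hquot n h1 hn).exists
    exact (abs_nonneg _).trans hx
  have htnn : ∀ k ≤ N, 0 ≤ t k := fun k => by
    induction k with
    | zero => simp [ht0]
    | succ k ih => intro hk; linarith [ih (by omega), ht k (by omega)]
  obtain ⟨m, rfl⟩ := Nat.exists_eq_add_of_le' h1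
  -- The summand of the current level is at most half of the left side; absorbing it doubles both
  -- constants.
  have hgr := discrete_gronwall (N := N) (y := fun k => l2norm a b (u' k - u k) ^ 2)
    (A := 2 * l2norm a b (u' 0 - u 0) ^ 2) (C := 4 * gam⁻¹ * c) ht0 (by positivity) (by positivity)
    (fun k hk => (ht k hk).le) (fun k hk => by
      have h := hu.l2norm_sub_sq_le hu' ht hB hc hquot (n := k + 1) hk
      rw [Finset.sum_range_succ] at h
      have h2 : 2 * gam⁻¹ * c * (t (k + 1) - t k) ≤ 1 / 2 := by
        simpa [step] using (hstep (k + 1) (by omega) hk).le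
      have h3 := mul_le_mul_of_nonneg_right h2 (sq_nonneg (l2norm a b (u' (k + 1) - u (k + 1))))
      linarith) m (by omega)
  have hX : 0 ≤ 4 * gam⁻¹ * c * t m := mul_nonneg (by positivity) (htnn m (by omega))
  have hE := Real.one_le_exp hX
  -- In squares: `2 exp X ≤ (2 exp X)²`, since `exp X ≥ 1`.
  refine le_of_sq_le_sq (hgr.trans ?_) (mul_nonneg (by positivity) (l2norm_nonneg _))
  rw [Nat.add_sub_cancel]
  nlinarith [mul_nonneg (sq_nonneg (l2norm a b (u' 0 - u 0)))
    (mul_nonneg (Real.exp_pos (4 * gam⁻¹ * c * t m)).le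
      (show 0 ≤ 2 * Real.exp (4 * gam⁻¹ * c * t m) - 1 by linarith))]

/-! ### Energy decay and the `H¹` bound -/

/-- The double well has second derivative `3z² - 1 ≥ -1`, so adding `z² / 2` makes it convex; the
quadratic term is the price. -/
theorem le_force_mul_sub (z z' : ℝ) :
    1 / 4 * (z ^ 2 - 1) ^ 2 - 1 / 4 * (z' ^ 2 - 1) ^ 2 - 1 / 2 * (z - z') ^ 2
      ≤ force z * (z - z') := by
  have h : force z * (z - z') - (1 / 4 * (z ^ 2 - 1) ^ 2 - 1 / 4 * (z' ^ 2 - 1) ^ 2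
      - 1 / 2 * (z - z') ^ 2) = 1 / 4 * ((z - z') ^ 2 * ((z + z') ^ 2 + 2 * z ^ 2)) := by
    simp only [force]
    ring
  have : 0 ≤ 1 / 4 * ((z - z') ^ 2 * ((z + z') ^ 2 + 2 * z ^ 2)) := by positivity
  linarith

theorem le_inner_sub {F : Type*} [NormedAddCommGroup F] [InnerProductSpace ℝ F] (x y : F) :
    1 / 2 * ‖x‖ ^ 2 - 1 / 2 * ‖y‖ ^ 2 ≤ inner ℝ x (x - y) := by
  have h := norm_sub_sq_real x y
  rw [inner_sub_right, real_inner_self_eq_norm_sq]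
  nlinarith [sq_nonneg ‖x - y‖]

/-- Membership in `L²` alone does not make the quartic potential integrable, and a divergent
integral would count as `0` in `energy`. -/
theorem integrable_sq_sub_one_sq {v : EuclideanSpace ℝ (Fin d) → ℝ} {C : ℝ}
    (hv : MemLp v 2 (cellMeasure a b)) (hC : ∀ᵐ x ∂(cellMeasure a b), |v x| ≤ C) :
    Integrable (fun x => (v x ^ 2 - 1) ^ 2) (cellMeasure a b) := by
  refine Integrable.of_bound (((hv.1.pow 2).sub aestronglyMeasurable_const).pow 2)
    ((C ^ 2 + 1) ^ 2) ?_
  filter_upwards [hC] with x hx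
  rw [Real.norm_eq_abs, abs_pow]
  have h2 : v x ^ 2 ≤ C ^ 2 := by
    rw [← sq_abs (v x)]
    exact pow_le_pow_left₀ (abs_nonneg _) hx 2
  refine pow_le_pow_left₀ (abs_nonneg _) (abs_le.2 ⟨?_, ?_⟩) 2 <;> nlinarith [sq_nonneg (v x)]

theorem energy_eq_integral {v : EuclideanSpace ℝ (Fin d) → ℝ}
    {q : EuclideanSpace ℝ (Fin d) → EuclideanSpace ℝ (Fin d)}
    (hq : MemLp q 2 (cellMeasure a b))
    (hv : Integrable (fun x => (v x ^ 2 - 1) ^ 2) (cellMeasure a b)) :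
    energy a b ε v q
      = ∫ x, (ε ^ 2 / 2 * ‖q x‖ ^ 2 + 1 / 4 * (v x ^ 2 - 1) ^ 2) ∂(cellMeasure a b) := by
  have hq2 : Integrable (fun x => ‖q x‖ ^ 2) (cellMeasure a b) := hq.integrable_norm_pow (by simp)
  rw [integral_add (hq2.const_mul _) (hv.const_mul _), integral_const_mul, integral_const_mul,
    energy, l2norm_sq, l2norm_sq]
  simp only [Real.norm_eq_abs, sq_abs]

/-- Energy decay for essentially bounded solutions. -/
theorem IsSchemeSolution.energy_le (hu : IsSchemeSolution a b ε t N u p)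
    (ht : ∀ k < N, t k < t (k + 1))
    (hB : MatrixGT (kernelMatrix t N) (gam • (stepMatrix t N)⁻¹))
    (hstep : ∀ k < N, step t (k + 1) ≤ 2 * gam)
    (hbdd : ∀ k ≤ N, ∃ C, ∀ᵐ x ∂(cellMeasure a b), |u k x| ≤ C) {n : ℕ} (hn : n ≤ N) :
    energy a b ε (u n) (p n) ≤ energy a b ε (u 0) (p 0) := by
  have hle : ∀ i : Fin n, (i : ℕ) + 1 ≤ N := fun i => i.2.trans_le hn
  let Φ : ℕ → EuclideanSpace ℝ (Fin d) → ℝ := fun k x =>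
    ε ^ 2 / 2 * ‖p k x‖ ^ 2 + 1 / 4 * (u k x ^ 2 - 1) ^ 2
  have hpot : ∀ k ≤ N, Integrable (fun x => (u k x ^ 2 - 1) ^ 2) (cellMeasure a b) := fun k hk =>
    let ⟨_, hC⟩ := hbdd k hk
    integrable_sq_sub_one_sq (hu.mem_H1 k hk).memLp hC
  have hΦ : ∀ k ≤ N, Integrable (Φ k) (cellMeasure a b) := fun k hk =>
    (((hu.mem_H1 k hk).memLp_grad.integrable_norm_pow (by simp)).const_mul _).add
      ((hpot k hk).const_mul _)
  have hE : ∀ k ≤ N, energy a b ε (u k) (p k) = ∫ x, Φ k x ∂(cellMeasure a b) := fun k hk =>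
    energy_eq_integral (hu.mem_H1 k hk).memLp_grad (hpot k hk)
  have hweak := fun k : Fin n => hu.integral_weak_eq (n := (k : ℕ) + 1) (by omega) (hle k)
    ((hu.mem_H1 (k + 1) (hle k)).sub (hu.mem_H1 k (by omega)))
  have hsum := integral_finsetSum Finset.univ (fun k _ => (hweak k).1)
  rw [Finset.sum_eq_zero fun k _ => (hweak k).2] at hsum
  have hmono := integral_mono ((hΦ n hn).sub (hΦ 0 (Nat.zero_le N)))
    (integrable_finsetSum _ fun k _ => (hweak k).1) (fun x => by
      simp only [Finset.sum_add_distrib, Pi.sub_apply]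
      -- `τ ≤ 2γ` makes `γ / τ ≥ 1 / 2`, exactly what the nonconvexity of the double well costs.
      have hI : 1 / 2 * ∑ k : Fin n, (u (k + 1) x - u k x) ^ 2
          ≤ ∑ k : Fin n, D3 t u (k + 1) x * (u (k + 1) x - u k x) := by
        have h := le_quadForm_kernelMatrix hB ht hn fun k => u (k + 1) x - u k x
        simp only [D3_succ t u]
        refine le_trans ?_ (h.trans (le_of_eq (Finset.sum_congr rfl fun k _ => mul_comm _ _)))
        rw [Finset.mul_sum, Finset.mul_sum]
        refine Finset.sum_le_sum fun k _ => ?_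
        have hτ := step_pos ht (k.2.trans_le hn)
        rw [mul_div_assoc', le_div_iff₀ hτ]
        nlinarith [mul_le_mul_of_nonneg_right (hstep k (k.2.trans_le hn))
          (sq_nonneg (u (k + 1) x - u k x))]
      have hII : Φ n x - Φ 0 x - 1 / 2 * ∑ k : Fin n, (u (k + 1) x - u k x) ^ 2
          ≤ ∑ k : Fin n, ε ^ 2 * inner ℝ (p (k + 1) x) (p (k + 1) x - p k x)
            + ∑ k : Fin n, force (u (k + 1) x) * (u (k + 1) x - u k x) := by
        rw [← Finset.sum_range_sub (fun k => Φ k x), ← Fin.sum_univ_eq_sum_range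
          (fun k => Φ (k + 1) x - Φ k x), Finset.mul_sum, ← Finset.sum_sub_distrib,
          ← Finset.sum_add_distrib]
        refine Finset.sum_le_sum fun k _ => ?_
        have h1 := le_force_mul_sub (u (k + 1) x) (u k x)
        have h2 := mul_le_mul_of_nonneg_left (le_inner_sub (p (k + 1) x) (p k x)) (sq_nonneg ε)
        simp only [Φ]
        linarith
      linarith)
  rw [hsum] at hmono
  simp only [Pi.sub_apply] at hmono
  rw [integral_sub (hΦ n hn) (hΦ 0 (Nat.zero_le N)), ← hE n hn, ← hE 0 (Nat.zero_le N)] at hmono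
  linarith

theorem energy_nonneg (v : EuclideanSpace ℝ (Fin d) → ℝ)
    (q : EuclideanSpace ℝ (Fin d) → EuclideanSpace ℝ (Fin d)) : 0 ≤ energy a b ε v q := by
  unfold energy
  positivity

theorem h1Bound_sq {E₀ : ℝ} (hE : 0 ≤ E₀) :
    h1Bound a b ε E₀ ^ 2 = 4 * (ε ^ 2)⁻¹ * E₀ + (2 + ε ^ 2) * cellVolume a b := by
  have : 0 ≤ cellVolume a b := measureReal_nonneg
  exact Real.sq_sqrt (by positivity)

/-- The energy controls the `H¹` norm. -/
theorem h1norm_sq_le (hε : 0 < ε) {v : EuclideanSpace ℝ (Fin d) → ℝ}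
    {q : EuclideanSpace ℝ (Fin d) → EuclideanSpace ℝ (Fin d)}
    (hv : MemLp v 2 (cellMeasure a b))
    (hpot : Integrable (fun x => (v x ^ 2 - 1) ^ 2) (cellMeasure a b)) :
    l2norm a b v ^ 2 + l2norm a b q ^ 2
      ≤ 4 * (ε ^ 2)⁻¹ * energy a b ε v q + (2 + ε ^ 2) * cellVolume a b := by
  have hvol : 0 ≤ cellVolume a b := measureReal_nonneg
  have hE := energy_nonneg (a := a) (b := b) (ε := ε) v q
  have hv2 : Integrable (fun x => ε ^ 2 / 2 * v x ^ 2) (cellMeasure a b) :=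
    hv.integrable_sq.const_mul _
  have hrhs : Integrable (fun x => 1 / 4 * (v x ^ 2 - 1) ^ 2 + (2 * ε ^ 2 + ε ^ 4) / 4)
      (cellMeasure a b) := (hpot.const_mul _).add (integrable_const _)
  have h := integral_mono hv2 hrhs fun x => by
    simp only
    -- This square gives `ε² v² / 2 ≤ (v² - 1)² / 4 + (2ε² + ε⁴) / 4`. The resulting `H¹` bound is
    -- half of the claimed one.
    nlinarith [sq_nonneg (v x ^ 2 - (1 + ε ^ 2))]
  rw [integral_add (hpot.const_mul _) (integrable_const _), integral_const_mul,
    integral_const_mul, integral_const, cellMeasure_real_univ, smul_eq_mul] at h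
  have h1 : l2norm a b v ^ 2 = ∫ x, v x ^ 2 ∂(cellMeasure a b) := by
    rw [l2norm_sq]
    simp only [Real.norm_eq_abs, sq_abs]
  have h2 : l2norm a b (fun x => v x ^ 2 - 1) ^ 2
      = ∫ x, (v x ^ 2 - 1) ^ 2 ∂(cellMeasure a b) := by
    rw [l2norm_sq]
    simp only [Real.norm_eq_abs, sq_abs]
  have h3 : ε ^ 2 / 2 * (l2norm a b v ^ 2 + l2norm a b q ^ 2)
      ≤ energy a b ε v q + cellVolume a b * ((2 * ε ^ 2 + ε ^ 4) / 4) := by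
    rw [energy, h2, h1]
    linarith
  have h4 : l2norm a b v ^ 2 + l2norm a b q ^ 2
      ≤ (2 * (ε ^ 2)⁻¹) * (energy a b ε v q + cellVolume a b * ((2 * ε ^ 2 + ε ^ 4) / 4)) := by
    have h5 := mul_le_mul_of_nonneg_left h3 (show 0 ≤ 2 * (ε ^ 2)⁻¹ by positivity)
    refine le_trans (le_of_eq ?_) h5
    field_simp
  have h6 : (2 * (ε ^ 2)⁻¹) * (cellVolume a b * ((2 * ε ^ 2 + ε ^ 4) / 4))
      = (2 + ε ^ 2) / 2 * cellVolume a b := by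
    field_simp
    ring
  have h7 : 0 ≤ (2 + ε ^ 2) / 2 * cellVolume a b := by positivity
  have h8 : 0 ≤ (ε ^ 2)⁻¹ * energy a b ε v q := by positivity
  linarith

/-- Apply the embedding to the constant function `1`. -/
theorem IsEmbeddingConstant.one_le (hab : ∀ i, a i < b i) {cΩ : ℝ}
    (h : IsEmbeddingConstant a b cΩ) : 0 < cΩ ∧ 1 ≤ cΩ ^ 2 * cellVolume a b := by
  have := cellMeasure_neZero hab
  obtain ⟨x, hx⟩ := (h _ _ (hasPeriodicWeakGrad_one hab)).exists
  have h1 : l2norm a b (fun _ => (1 : ℝ)) ^ 2 = cellVolume a b := by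
    rw [l2norm_sq]
    simp [cellMeasure_real_univ]
  have h2 : l2norm a b (0 : EuclideanSpace ℝ (Fin d) → EuclideanSpace ℝ (Fin d)) ^ 2 = 0 := by
    rw [l2norm_sq]
    simp
  rw [h1, h2, add_zero, abs_one] at hx
  have hV := cellVolume_pos hab
  refine ⟨pos_of_mul_pos_left (one_pos.trans_le hx) (Real.sqrt_nonneg _), ?_⟩
  rw [← Real.sq_sqrt hV.le, ← mul_pow]
  exact one_le_pow₀ hx

/-- The pointwise bound of essentially bounded solutions by the energy of the initial value. -/
theorem IsSchemeSolution.ae_abs_le (hab : ∀ i, a i < b i) (hε : 0 < ε)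
    (hu : IsSchemeSolution a b ε t N u p) (ht : ∀ k < N, t k < t (k + 1))
    (hB : MatrixGT (kernelMatrix t N) (gam • (stepMatrix t N)⁻¹))
    (hstep : ∀ k < N, step t (k + 1) ≤ 2 * gam) {cΩ : ℝ} (hc : IsEmbeddingConstant a b cΩ)
    {n : ℕ} (hn : n ≤ N) :
    ∀ᵐ x ∂(cellMeasure a b), |u n x| ≤ cΩ * h1Bound a b ε (energy a b ε (u 0) (p 0)) := by
  -- The embedding enters twice: here only for integrability of the potentials, at the end for the
  -- explicit bound.
  have hbdd : ∀ k ≤ N, ∃ C, ∀ᵐ x ∂(cellMeasure a b), |u k x| ≤ C := fun k hk =>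
    ⟨_, hc _ _ (hu.mem_H1 k hk)⟩
  have hE := hu.energy_le ht hB hstep hbdd hn
  obtain ⟨C, hC⟩ := hbdd n hn
  have hH := h1norm_sq_le (q := p n) hε (hu.mem_H1 n hn).memLp
    (integrable_sq_sub_one_sq (hu.mem_H1 n hn).memLp hC)
  filter_upwards [hc _ _ (hu.mem_H1 n hn)] with x hx
  refine hx.trans (mul_le_mul_of_nonneg_left (Real.sqrt_le_sqrt (hH.trans ?_)) (hc.one_le hab).1.le)
  gcongr

/-- The quotient is `1 - Q` with a form `0 ≤ Q ≤ c`, so `1 ≤ c` suffices and no extra `1` is added.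
-/
theorem abs_forceQuot_le {z z' A A' c : ℝ} (hz : |z| ≤ A) (hz' : |z'| ≤ A') (h1 : 1 ≤ c)
    (hc : A ^ 2 + A * A' + A' ^ 2 ≤ c) : |forceQuot z z'| ≤ c := by
  have h2 : z ^ 2 ≤ A ^ 2 := by
    rw [← sq_abs z]
    exact pow_le_pow_left₀ (abs_nonneg _) hz 2
  have h3 : z' ^ 2 ≤ A' ^ 2 := by
    rw [← sq_abs z']
    exact pow_le_pow_left₀ (abs_nonneg _) hz' 2
  have h4 : z * z' ≤ A * A' := (le_abs_self _).trans <| by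
    rw [abs_mul]
    exact mul_le_mul hz hz' (abs_nonneg _) ((abs_nonneg _).trans hz)
  rw [forceQuot, abs_le]
  constructor <;> nlinarith [sq_nonneg (z + z'), sq_nonneg z, sq_nonneg z']

/-- `c₁² ≥ 2|Ω|` and `cΩ² |Ω| ≥ 1`. This yields both `1 ≤ c̃` and the step restriction for energy
decay. -/
theorem two_le_stabConst (hab : ∀ i, a i < b i) {cΩ E₀ E₀' : ℝ}
    (hc : IsEmbeddingConstant a b cΩ) (hE : 0 ≤ E₀) :
    2 ≤ stabConst a b cΩ (h1Bound a b ε E₀) (h1Bound a b ε E₀') := by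
  have hV := cellVolume_pos hab
  have h1 := hc.one_le hab
  have h2 : 2 * cellVolume a b ≤ h1Bound a b ε E₀ ^ 2 := by
    rw [h1Bound_sq hE]
    have h3 : 0 ≤ 4 * (ε ^ 2)⁻¹ * E₀ := by positivity
    nlinarith [mul_nonneg (sq_nonneg ε) hV.le]
  have h4 : 0 ≤ cΩ ^ 2 * h1Bound a b ε E₀ * h1Bound a b ε E₀' :=
    mul_nonneg (mul_nonneg (sq_nonneg _) (Real.sqrt_nonneg _)) (Real.sqrt_nonneg _)
  have h5 : 0 ≤ cΩ ^ 2 * h1Bound a b ε E₀' ^ 2 := by positivity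
  have h6 := mul_le_mul_of_nonneg_left h2 (sq_nonneg cΩ)
  unfold stabConst
  linarith

end Scheme

end BDF3

/-! ### The stability theorem -/

theorem theorem5p1 {d : ℕ} (a b : Fin d → ℝ) (hab : ∀ i, a i < b i)
    (ε : ℝ) (hε : 0 < ε)
    (N : ℕ) (t : ℕ → ℝ) (ht0 : t 0 = 0) (ht : ∀ k < N, t k < t (k + 1))
    (hB : BDF3.MatrixGT (BDF3.kernelMatrix t N) (BDF3.gam • (BDF3.stepMatrix t N)⁻¹))
    (u u' : ℕ → EuclideanSpace ℝ (Fin d) → ℝ)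
    (p p' : ℕ → EuclideanSpace ℝ (Fin d) → EuclideanSpace ℝ (Fin d))
    (hu : BDF3.IsSchemeSolution a b ε t N u p)
    (hu' : BDF3.IsSchemeSolution a b ε t N u' p') :
    -- the bound with the explicit constant, whenever `H¹_per(Ω) ⊆ L^∞(Ω)`
    (∀ cΩ c : ℝ, BDF3.IsEmbeddingConstant a b cΩ →
      c = BDF3.stabConst a b cΩ
        (BDF3.h1Bound a b ε (BDF3.energy a b ε (u 0) (p 0)))
        (BDF3.h1Bound a b ε (BDF3.energy a b ε (u' 0) (p' 0))) →
      (∀ n, 1 ≤ n → n ≤ N → 2 * BDF3.gam⁻¹ * c * BDF3.step t n < 1 / 2) →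
      ∀ n, 1 ≤ n → n ≤ N →
        BDF3.l2norm a b (u' n - u n) ≤
          2 * Real.exp (4 * BDF3.gam⁻¹ * c * t (n - 1)) * BDF3.l2norm a b (u' 0 - u 0)) ∧
    -- in dimension one such an embedding constant exists
    (d = 1 → ∃ cΩ : ℝ, BDF3.IsEmbeddingConstant a b cΩ) ∧
    -- in any dimension, the bound with any constant that dominates the difference quotient
    (∀ c : ℝ,
      (∀ n, 1 ≤ n → n ≤ N →
        ∀ᵐ x ∂(BDF3.cellMeasure a b), |BDF3.forceQuot (u n x) (u' n x)| ≤ c) →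
      (∀ n, 1 ≤ n → n ≤ N → 2 * BDF3.gam⁻¹ * c * BDF3.step t n < 1 / 2) →
      ∀ n, 1 ≤ n → n ≤ N →
        BDF3.l2norm a b (u' n - u n) ≤
          2 * Real.exp (4 * BDF3.gam⁻¹ * c * t (n - 1)) * BDF3.l2norm a b (u' 0 - u 0)) := by
  refine ⟨fun cΩ c hcΩ hc hstep n h1 hn => ?_, fun hd => ?_, fun c hquot hstep n h1 hn =>
    hu.l2norm_sub_le hab hu' ht0 ht hB hquot hstep h1 hn⟩
  · have hc2 : 2 ≤ c := hc ▸ BDF3.two_le_stabConst hab hcΩ (BDF3.energy_nonneg _ _)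
    have hτ : ∀ k < N, BDF3.step t (k + 1) ≤ 2 * BDF3.gam := fun k hk => by
      have h2 := hstep (k + 1) (by omega) hk
      have h3 := mul_le_mul_of_nonneg_right hc2 (BDF3.step_pos ht hk).le
      norm_num [BDF3.gam] at h2 ⊢
      linarith
    refine hu.l2norm_sub_le hab hu' ht0 ht hB (fun m _ hm => ?_) hstep h1 hn
    filter_upwards [hu.ae_abs_le hab hε ht hB hτ hcΩ hm, hu'.ae_abs_le hab hε ht hB hτ hcΩ hm]
      with x hx hx'
    refine BDF3.abs_forceQuot_le hx hx' (by linarith) ?_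
    -- Of the summand `|Ω|` in `c̃` only the sign is needed.
    have hV := BDF3.cellVolume_pos hab
    rw [hc, BDF3.stabConst]
    linarith
  · subst hd
    exact BDF3.exists_isEmbeddingConstant hab
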